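/- Let $\Bbbk$ be an algebraically closed field of characteristic zero. For positive integers $n,d$ let $\mathbb P^{\binom{n+d}{d}-1}$ be the projective space of forms of degree $d$ in $x_0,\ldots,x_n$ over $\Bbbk$, and let $\mathrm{Split}_d(\mathbb P^n)$ be the variety of all points $[f]$ in it such that $f$ is a product of $d$ linear forms. For a projective variety $X\subset\mathbb P^N$ and a positive integer $s$, the secant variety $\sigma_s(X)$ is the Zariski closure of the union of the linear spans $\langle p_1,\ldots,p_s\rangle$ of $s$ points $p_1,\ldots,p_s\in X$; it is called nondefective if its dimension is not less than the expected dimension $\min\{s(\dim X+1)-1,\,N\}$. Define $$\tilde s(d)=\begin{cases}\frac1{24}d^2+\frac1{12}d&\text{if }d\equiv0,4\pmod 6\\ \frac1{24}d^2+\frac16d-\frac5{24}&\text{if }d\equiv1\pmod 6\\ \frac1{24}d^2+\frac1{12}d-\frac13&\text{if }d\equiv2\pmod 6\\ \frac1{24}d^2+\frac16d+\frac18&\text{if }d\equiv3,5\pmod 6,\end{cases}$$ for $n\ge4$ and $0\le m\le n-2$ $$g_n(m)=\begin{cases}n-3&\text{if }m=0\text{ or }m=n-3\\ n-4&\text{if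 }n\ge5\text{ and }m=1\\ 1&\text{if }m=n-2\\ m(n-m-3)&\text{if }2\le m\le n-4,\end{cases}$$ and for $d\ge n\ge4$ $$c(n,d)=\min\left\{\left\lfloor\frac{\tilde s(d-m)}{g_n(m)}\right\rfloor:0\le m\le n-2\right\}.$$ If $d\ge n\ge4$ and $s$ is a positive integer with $s\le2^{n-3}c(n,d)$, then $\sigma_s(\mathrm{Split}_d(\mathbb P^n))$ is nondefective. -/

import Mathlib

open scoped LinearAlgebra.Projectivization

noncomputable section

namespace SplitSecant

/-! ### Projective sets, their Zariski closure and their dimension -/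

section Projective

variable {k : Type*} [Field k] {ι : Type*}

/-- The affine cone over a set `X` of points of `ℙ(k^ι)`: the vector `0` together with all
vectors that represent a point of `X`. -/
def affineCone (X : Set (ℙ k (ι → k))) : Set (ι → k) :=
  {v | ∀ hv : v ≠ 0, Projectivization.mk k v hv ∈ X}

/-- The Zariski closure of `X` in `ℙ(k^ι)`: the points at which every homogeneous polynomial
that vanishes on `X` vanishes. -/
def zariskiClosure (X : Set (ℙ k (ι → k))) : Set (ℙ k (ι → k)) :=
  {p | ∀ (e : ℕ) (F : MvPolynomial ι k), F.IsHomogeneous e →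
    (∀ q ∈ X, MvPolynomial.eval q.rep F = 0) → MvPolynomial.eval p.rep F = 0}

/-- The Krull dimension of the homogeneous coordinate ring `k[x_i : i ∈ ι] / I(X)` of `X`, that
is, the dimension of the affine cone over `X`. -/
def coneDim (X : Set (ℙ k (ι → k))) : WithBot ℕ∞ :=
  ringKrullDim (MvPolynomial ι k ⧸ MvPolynomial.vanishingIdeal k (affineCone X))

/-- The dimension of a projective set: the dimension of its affine cone minus one
(so that the empty set has dimension `-1`). -/
def projDim (X : Set (ℙ k (ι → k))) : ℤ :=
  (((coneDim X).unbotD 0).toNat : ℤ) - 1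

/-- In a finite-dimensional space the dimension of the cone is a natural number, so
that no information is lost in `projDim`. -/
theorem coneDim_eq_coe [Finite ι] (X : Set (ℙ k (ι → k))) :
    coneDim X = ((((coneDim X).unbotD 0).toNat : ℕ) : WithBot ℕ∞) := by
  have hne : MvPolynomial.vanishingIdeal k (affineCone X) ≠ ⊤ := by
    intro h
    have h1 : (1 : MvPolynomial ι k) ∈ MvPolynomial.vanishingIdeal k (affineCone X) := by
      rw [h]; trivial
    have h0 : (0 : ι → k) ∈ affineCone X := fun hv => absurd rfl hv
    have := h1 0 h0
    simp at this
  have : Nontrivial (MvPolynomial ι k ⧸ MvPolynomial.vanishingIdeal k (affineCone X)) :=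
    Ideal.Quotient.nontrivial_iff.mpr hne
  have hbot : coneDim X ≠ ⊥ := by
    intro h
    have h0 : (0 : WithBot ℕ∞) ≤ coneDim X := ringKrullDim_nonneg_of_nontrivial
    rw [h] at h0
    exact absurd h0 (by simp)
  have hle : coneDim X ≤ ((Nat.card ι : ℕ) : WithBot ℕ∞) := by
    refine (ringKrullDim_quotient_le _).trans ?_
    rw [MvPolynomial.ringKrullDim_of_isNoetherianRing]
    simp
  generalize coneDim X = a at hbot hle
  induction a with
  | bot => exact absurd rfl hbot
  | coe a =>
    have ha : a ≠ ⊤ := by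
      rintro rfl
      have h2 : (⊤ : ℕ∞) ≤ (Nat.card ι : ℕ) := WithBot.coe_le_coe.mp hle
      exact absurd h2 (by simp)
    lift a to ℕ using ha
    rfl

/-- The `s`-th secant variety of `X`: the Zariski closure of the union of the linear spans
`⟨p₁, …, pₛ⟩` of `s` points of `X`. -/
def secantVariety (s : ℕ) (X : Set (ℙ k (ι → k))) : Set (ℙ k (ι → k)) :=
  zariskiClosure
    {q | ∃ p : Fin s → ℙ k (ι → k), (∀ i, p i ∈ X) ∧
      q ∈ Projectivization.Subspace.span (Set.range p)}

/-- The expected dimension `min {s (dim X + 1) - 1, N}` of the `s`-th secant variety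
of `X ⊆ ℙ^N = ℙ(k^ι)`, where `N + 1` is the number of coordinates. -/
def expectedDim [Fintype ι] (s : ℕ) (X : Set (ℙ k (ι → k))) : ℤ :=
  min ((s : ℤ) * (projDim X + 1) - 1) ((Fintype.card ι : ℤ) - 1)

/-- The `s`-th secant variety of `X` is defective if its dimension is smaller than expected. -/
def SecantDefective [Fintype ι] (s : ℕ) (X : Set (ℙ k (ι → k))) : Prop :=
  projDim (secantVariety s X) < expectedDim s X

/-- The `s`-th secant variety of `X` is nondefective if it is not defective. -/
def SecantNondefective [Fintype ι] (s : ℕ) (X : Set (ℙ k (ι → k))) : Prop :=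
  ¬ SecantDefective s X

end Projective

/-! ### The variety of completely decomposable forms -/

/-- The exponents of the monomials of degree `d` in `x_0, …, x_n`. -/
abbrev Monomials (n d : ℕ) : Type :=
  {m : Fin (n + 1) →₀ ℕ // m ∈ Finset.finsuppAntidiag (Finset.univ : Finset (Fin (n + 1))) d}

/-- The form of degree `d` in `x_0, …, x_n` with coefficient vector `a`. -/
def formOfCoeffs {k : Type*} [Field k] {n d : ℕ} (a : Monomials n d → k) :
    MvPolynomial (Fin (n + 1)) k :=
  ∑ m, MvPolynomial.monomial m.1 (a m)

/-- A completely decomposable form of degree `d` is a product of `d` linear forms. -/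
def IsCompletelyDecomposable {k : Type*} [Field k] {n : ℕ} (d : ℕ)
    (f : MvPolynomial (Fin (n + 1)) k) : Prop :=
  ∃ l : Fin d → MvPolynomial (Fin (n + 1)) k, (∀ i, (l i).IsHomogeneous 1) ∧ f = ∏ i, l i

/-- The variety `Split_d(ℙ^n)` of completely decomposable forms, in the projective space of
all forms of degree `d` in `n + 1` variables over `k`. -/
def Split (k : Type*) [Field k] (n d : ℕ) : Set (ℙ k (Monomials n d → k)) :=
  {p | ∃ (a : Monomials n d → k) (ha : a ≠ 0),
    p = Projectivization.mk k a ha ∧ IsCompletelyDecomposable d (formOfCoeffs a)}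

/-! ### The numerical functions -/

/-- The quasi-polynomial `s̃(d)`. -/
def sTilde (d : ℕ) : ℚ :=
  if d % 6 = 0 ∨ d % 6 = 4 then 1 / 24 * (d : ℚ) ^ 2 + 1 / 12 * (d : ℚ)
  else if d % 6 = 1 then 1 / 24 * (d : ℚ) ^ 2 + 1 / 6 * (d : ℚ) - 5 / 24
  else if d % 6 = 2 then 1 / 24 * (d : ℚ) ^ 2 + 1 / 12 * (d : ℚ) - 1 / 3
  else 1 / 24 * (d : ℚ) ^ 2 + 1 / 6 * (d : ℚ) + 1 / 8

/-- The function `g_n(m)`, for `n ≥ 4` and `0 ≤ m ≤ n - 2`. -/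
def g (n m : ℕ) : ℚ :=
  if m = 0 ∨ m = n - 3 then (n : ℚ) - 3
  else if 5 ≤ n ∧ m = 1 then (n : ℚ) - 4
  else if m = n - 2 then 1
  else (m : ℚ) * ((n : ℚ) - (m : ℚ) - 3)

/-- `c(n, d) = min {⌊s̃(d - m) / g_n(m)⌋ : 0 ≤ m ≤ n - 2}`, for `d ≥ n ≥ 4`. -/
def c (n d : ℕ) : ℤ :=
  (Finset.Icc 0 (n - 2)).inf' (Finset.nonempty_Icc.mpr (Nat.zero_le _))
    fun m => ⌊sTilde (d - m) / g n m⌋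

end SplitSecant

end

open scoped LinearAlgebra.Projectivization
noncomputable section
namespace SplitSecant

/-! ### Krull dimension, transcendence degree and images of polynomial maps. -/

section Dimension

/-! The hypothesis on `s` enters only through the estimate `le_choose_of_le_two_pow_mul_c`, which
gives `s ≤ C(e + r, r)` with `r = ⌊n/2⌋` and `e = ⌊(d-1)/2⌋ - 1`. For all such `s` the secant
variety has dimension at least `s(dn + 1) - 1`, and this is enough because `Split` has dimension at
most `dn` (`projDim_split_le`).

The lower bound is Terracini's argument in coordinates. Sums of `s` scaled products of linear forms
with coefficient `1` at `X 0` depend on `s(dn + 1)` parameters. If at one parameter point the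
partial derivatives are linearly independent, the Jacobian criterion makes as many elements of the
coordinate ring algebraically independent (`card_param_le_ringKrullDim`).

The parameter point is special: the `w`-th product consists of `d` distinct members of a pencil of
linear forms, that is, of a line `L_w` in the space of linear forms. Under the apolar pairing,
testing a product of members of the pencil against `G` only sees the restriction of `G` to `L_w`,
and testing a tangent vector only sees `G` and its first derivatives there. A `G` vanishing doubly
on all other lines therefore isolates one summand. Such `G` are products of two forms of degree `κ =
e + 1` vanishing on the other lines, times a monomial, and `2κ ≤ d - 1` leaves room for them. With
the summands separated, independence becomes a statement about binary forms with distinct roots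
(`tangent_independent`).

It remains to find `C(e + r, r)` lines imposing independent conditions on forms of degree `e + 1`.
The family `lineMatrix` has `r` parameters, and every polynomial of degree at most `e` in them,
times any binary monomial of degree `e + 1`, is the restriction of a form
(`attained_of_totalDegree_le`). Lagrange interpolation at the lattice points of a simplex then
separates the lines (`linesSeparated_simplex`). -/

theorem ringKrullDim_le_of_integral {R S : Type*} [CommRing R] [CommRing S] [Algebra R S]
    [Algebra.IsIntegral R S] : ringKrullDim S ≤ ringKrullDim R := by
  refine Order.krullDim_le_of_strictMono (PrimeSpectrum.comap (algebraMap R S)) ?_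
  intro I J hIJ
  exact Ideal.IsIntegral.comap_lt_comap (R := R) (I := I.asIdeal) (J := J.asIdeal) hIJ

theorem ringKrullDim_ge_of_integral {R S : Type*} [CommRing R] [CommRing S] [Algebra R S]
    [Algebra.IsIntegral R S] [FaithfulSMul R S] : ringKrullDim R ≤ ringKrullDim S := by
  refine iSup_le fun l => ?_
  obtain ⟨Q, -, hQ, hQl⟩ := Ideal.exists_ideal_over_prime_of_isIntegral l.head.asIdeal (⊥ : Ideal S)
    (by
      rw [← RingHom.ker_eq_comap_bot,
        (RingHom.injective_iff_ker_eq_bot _).mp (FaithfulSMul.algebraMap_injective R S)]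
      exact bot_le)
  have : Q.LiesOver l.head.asIdeal := ⟨hQl.symm⟩
  obtain ⟨L, hL, -⟩ := Ideal.exists_ltSeries_of_hasGoingUp l Q
  rw [← hL]
  exact Order.LTSeries.length_le_krullDim L

/-- Noether normalization: both invariants are unchanged along an integral extension of a polynomial
ring. -/
theorem exists_ringKrullDim_eq_trdeg (k B : Type*) [Field k] [CommRing B] [IsDomain B]
    [Algebra k B] [Algebra.FiniteType k B] :
    ∃ s : ℕ, ringKrullDim B = s ∧ Algebra.trdeg k B = s := by
  obtain ⟨s, f, hf, hint⟩ := exists_integral_inj_algHom_of_fg k B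
  algebraize [f.toRingHom]
  have : IsScalarTower k (MvPolynomial (Fin s) k) B := IsScalarTower.of_algHom f
  have : FaithfulSMul (MvPolynomial (Fin s) k) B :=
    (faithfulSMul_iff_algebraMap_injective _ _).mpr hf
  have : Algebra.IsIntegral (MvPolynomial (Fin s) k) B := ⟨hint⟩
  refine ⟨s, ?_, ?_⟩
  · rw [le_antisymm (ringKrullDim_le_of_integral (R := MvPolynomial (Fin s) k) (S := B))
      ringKrullDim_ge_of_integral, MvPolynomial.ringKrullDim_of_isNoetherianRing]
    simp
  · have h := lift_trdeg_add_eq k (MvPolynomial (Fin s) k) B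
    rw [trdeg_eq_zero (R := MvPolynomial (Fin s) k) (A := B)] at h
    rw [MvPolynomial.trdeg_of_isDomain] at h
    simpa using h.symm

theorem card_le_ringKrullDim_of_algebraicIndependent {k B τ : Type*} [Field k] [CommRing B]
    [IsDomain B] [Algebra k B] [Algebra.FiniteType k B] [Fintype τ] {x : τ → B}
    (hx : AlgebraicIndependent k x) : (Fintype.card τ : WithBot ℕ∞) ≤ ringKrullDim B := by
  obtain ⟨s, h1, h2⟩ := exists_ringKrullDim_eq_trdeg k B
  have h := hx.lift_cardinalMk_le_trdeg
  rw [h2] at h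
  rw [h1]
  have : Fintype.card τ ≤ s := by simpa using h
  exact_mod_cast this

theorem ringKrullDim_le_card_of_injective {k B τ : Type*} [Field k] [CommRing B]
    [Algebra k B] [Algebra.FiniteType k B] [Fintype τ] (f : B →ₐ[k] MvPolynomial τ k)
    (hf : Function.Injective f) : ringKrullDim B ≤ Fintype.card τ := by
  have : IsDomain B := hf.isDomain f.toRingHom
  obtain ⟨s, h1, h2⟩ := exists_ringKrullDim_eq_trdeg k B
  have h := lift_trdeg_le_of_injective f hf
  rw [h2, MvPolynomial.trdeg_of_isDomain] at h
  rw [h1]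
  have : s ≤ Fintype.card τ := by simpa using h
  exact_mod_cast this

variable {k ι τ : Type*} [Field k] [Finite ι] [Fintype τ]

theorem ringKrullDim_quotient_le_card (φ : MvPolynomial ι k →ₐ[k] MvPolynomial τ k)
    (I : Ideal (MvPolynomial ι k)) (hI : RingHom.ker φ ≤ I) :
    ringKrullDim (MvPolynomial ι k ⧸ I) ≤ Fintype.card τ := by
  refine (ringKrullDim_le_of_surjective (Ideal.Quotient.factor hI)
    (Ideal.Quotient.factor_surjective hI)).trans ?_
  exact ringKrullDim_le_card_of_injective (Ideal.kerLiftAlg φ) (Ideal.kerLiftAlg_injective φ)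

/-- The quotient by `I` surjects onto the domain `im φ`, whose dimension is its transcendence
degree. -/
theorem card_le_ringKrullDim_quotient (φ : MvPolynomial ι k →ₐ[k] MvPolynomial τ k)
    (I : Ideal (MvPolynomial ι k)) (hI : I ≤ RingHom.ker φ) {Ψ : τ → MvPolynomial ι k}
    (hΨ : AlgebraicIndependent k fun t => φ (Ψ t)) :
    (Fintype.card τ : WithBot ℕ∞) ≤ ringKrullDim (MvPolynomial ι k ⧸ I) := by
  refine le_trans ?_ (ringKrullDim_le_of_surjective (Ideal.Quotient.factor hI)
    (Ideal.Quotient.factor_surjective hI))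
  have : IsDomain (MvPolynomial ι k ⧸ RingHom.ker φ) :=
    (Ideal.kerLiftAlg_injective φ).isDomain (Ideal.kerLiftAlg φ).toRingHom
  refine card_le_ringKrullDim_of_algebraicIndependent (k := k)
    (x := fun t => Ideal.Quotient.mkₐ k (RingHom.ker φ) (Ψ t)) ?_
  exact AlgebraicIndependent.of_comp (Ideal.kerLiftAlg φ) hΨ

end Dimension

/-! ### The Jacobian criterion for algebraic independence. -/

section Jacobian

variable {k τ : Type*} [Field k]

theorem pderiv_aeval {σ R : Type*} [CommRing R] [Fintype σ] (f : σ → MvPolynomial τ R) (t : τ)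
    (P : MvPolynomial σ R) :
    MvPolynomial.pderiv t (MvPolynomial.aeval f P) =
      ∑ i, MvPolynomial.aeval f (MvPolynomial.pderiv i P) * MvPolynomial.pderiv t (f i) := by
  classical
  induction P using MvPolynomial.induction_on with
  | C a => simp
  | add p q hp hq => simp only [map_add, hp, hq, add_mul, Finset.sum_add_distrib]
  | mul_X p i hp =>
    simp only [map_mul, MvPolynomial.aeval_X, Derivation.leibniz, hp, smul_eq_mul, map_add,
      MvPolynomial.pderiv_X, add_mul, Finset.sum_add_distrib, Finset.mul_sum]
    congr 1
    · rw [Finset.sum_eq_single i]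
      · simp
      · intro j _ hj
        simp [hj.symm]
      · simp
    · exact Finset.sum_congr rfl fun j _ => by ring

theorem eq_C_of_pderiv_eq_zero [CharZero k] (P : MvPolynomial τ k)
    (h : ∀ t, MvPolynomial.pderiv t P = 0) : P = MvPolynomial.C (MvPolynomial.coeff 0 P) := by
  classical
  ext m
  rw [MvPolynomial.coeff_C]
  split_ifs with hm
  · rw [hm]
  obtain ⟨t, ht⟩ : ∃ t, m t ≠ 0 := by
    by_contra! hc
    exact hm (Finsupp.ext fun t => (hc t).symm)
  have h1 := congrArg (MvPolynomial.coeff (m - Finsupp.single t 1)) (h t)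
  rw [MvPolynomial.coeff_pderiv] at h1
  have h2 : m - Finsupp.single t 1 + Finsupp.single t 1 = m :=
    tsub_add_cancel_of_le (Finsupp.single_le_iff.mpr (Nat.one_le_iff_ne_zero.mpr ht))
  rw [h2] at h1
  have h3 : ((m t - 1 : ℕ) : k) + 1 ≠ 0 := Nat.cast_add_one_ne_zero _
  simpa [h3] using h1

theorem totalDegree_pderiv_lt (P : MvPolynomial τ k) (t : τ)
    (h : MvPolynomial.pderiv t P ≠ 0) :
    (MvPolynomial.pderiv t P).totalDegree < P.totalDegree := by
  classical
  obtain ⟨m, hm, hmd⟩ := Finset.exists_mem_eq_sup _ (MvPolynomial.support_nonempty.mpr h)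
    (fun m : τ →₀ ℕ => m.sum fun _ e => e)
  rw [MvPolynomial.totalDegree, hmd]
  rw [MvPolynomial.mem_support_iff, MvPolynomial.coeff_pderiv] at hm
  have h1 := MvPolynomial.le_totalDegree (MvPolynomial.mem_support_iff.mpr (left_ne_zero_of_mul hm))
  rw [Finsupp.sum_add_index' (by simp) (by simp), Finsupp.sum_single_index rfl] at h1
  omega

/-- Differentiating a relation `P(Ψ) = 0` by the chain rule and cancelling the invertible Jacobian
shows that each `∂P/∂X_i` is again a relation. These have smaller degree, so by induction they are
zero, and in characteristic zero `P` is a constant. -/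
theorem algebraicIndependent_of_jacobian [CharZero k] [Fintype τ] [DecidableEq τ]
    (Ψ : τ → MvPolynomial τ k) (a : τ → k)
    (h : (Matrix.of fun i t => MvPolynomial.eval a (MvPolynomial.pderiv t (Ψ i))).det ≠ 0) :
    AlgebraicIndependent k Ψ := by
  have hdet : (Matrix.of fun t i => MvPolynomial.pderiv t (Ψ i)).det ≠ 0 := by
    intro h0
    apply h
    have := congrArg (MvPolynomial.eval a) h0
    rw [RingHom.map_det, map_zero, ← Matrix.det_transpose] at this
    exact this
  rw [algebraicIndependent_iff]
  intro P
  induction hd : P.totalDegree using Nat.strong_induction_on generalizing P with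
  | _ D ih =>
    intro hP
    have hz : ∀ i, MvPolynomial.aeval Ψ (MvPolynomial.pderiv i P) = 0 := by
      have := Matrix.eq_zero_of_mulVec_eq_zero hdet
        (v := fun i => MvPolynomial.aeval Ψ (MvPolynomial.pderiv i P)) (by
          ext1 t
          have h1 := pderiv_aeval Ψ t P
          rw [hP, map_zero] at h1
          simp only [Matrix.mulVec, dotProduct, Matrix.of_apply, Pi.zero_apply]
          rw [h1]
          exact Finset.sum_congr rfl fun i _ => mul_comm _ _)
      exact fun i => congrFun this i
    have hp : ∀ i, MvPolynomial.pderiv i P = 0 := by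
      intro i
      by_contra hne
      exact hne (ih _ (hd ▸ totalDegree_pderiv_lt P i hne) _ rfl (hz i))
    have hC := eq_C_of_pderiv_eq_zero P hp
    rw [hC, MvPolynomial.aeval_C] at hP
    rw [hC]
    have : MvPolynomial.coeff 0 P = 0 := by
      simpa using hP
    rw [this, map_zero]

end Jacobian

/-! ### The apolar pairing and its behaviour under linear substitution. -/

section Apolarity

open MvPolynomial
open scoped Nat

variable {k σ ρ : Type*} [Field k] [Fintype σ] [Fintype ρ]

/-- The apolar pairing `F ↦ ∑ α! F_α G_α` with a polynomial `G`. -/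
def apolar (G : MvPolynomial σ k) : MvPolynomial σ k →ₗ[k] k :=
  (basisMonomials σ k).constr k fun m => (∏ j, ((m j)! : k)) * coeff m G

theorem apolar_monomial (G : MvPolynomial σ k) (m : σ →₀ ℕ) (a : k) :
    apolar G (monomial m a) = a * ((∏ j, ((m j)! : k)) * coeff m G) := by
  have h : monomial m a = a • (basisMonomials σ k m) := by
    rw [coe_basisMonomials, smul_monomial, smul_eq_mul, mul_one]
  rw [h, map_smul, apolar, Module.Basis.constr_basis, smul_eq_mul]

theorem apolar_add (G H F : MvPolynomial σ k) : apolar (G + H) F = apolar G F + apolar H F := by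
  induction F using MvPolynomial.induction_on' with
  | monomial m a => simp only [apolar_monomial, coeff_add]; ring
  | add p q hp hq => rw [map_add, map_add, map_add, hp, hq]; ring

theorem apolar_C_mul (c : k) (G F : MvPolynomial σ k) :
    apolar (C c * G) F = c * apolar G F := by
  induction F using MvPolynomial.induction_on' with
  | monomial m a => simp only [apolar_monomial, coeff_C_mul]; ring
  | add p q hp hq => rw [map_add, map_add, hp, hq]; ring

theorem apolar_zero (F : MvPolynomial σ k) : apolar 0 F = 0 := by
  simpa using apolar_C_mul 0 0 F

theorem apolar_sum {κ : Type*} (s : Finset κ) (G : κ → MvPolynomial σ k) (F : MvPolynomial σ k) :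
    apolar (∑ i ∈ s, G i) F = ∑ i ∈ s, apolar (G i) F := by
  classical
  induction s using Finset.induction_on with
  | empty => simp [apolar_zero]
  | insert a s ha ih => rw [Finset.sum_insert ha, Finset.sum_insert ha, apolar_add, ih]

theorem apolar_C_mul_right (c : k) (G F : MvPolynomial σ k) :
    apolar G (C c * F) = c * apolar G F := by
  rw [← smul_eq_C_mul, map_smul, smul_eq_mul]

theorem apolar_monomial_left (m : σ →₀ ℕ) (F : MvPolynomial σ k) :
    apolar (monomial m 1) F = (∏ j, ((m j)! : k)) * coeff m F := by
  classical
  induction F using MvPolynomial.induction_on' with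
  | monomial m' a =>
    rw [apolar_monomial, coeff_monomial, coeff_monomial]
    by_cases h : m = m'
    · subst h; simp [mul_comm]
    · simp [h, Ne.symm h]
  | add p q hp hq => rw [map_add, hp, hq, coeff_add, mul_add]

/-- The factorials in the pairing are there for this: multiplication by a variable is adjoint to
differentiation. -/
theorem apolar_X_mul (j : σ) (G F : MvPolynomial σ k) :
    apolar G (X j * F) = apolar (pderiv j G) F := by
  classical
  induction F using MvPolynomial.induction_on' with
  | add p q hp hq => rw [mul_add, map_add, map_add, hp, hq]
  | monomial m a =>
    have hX : X j * monomial m a = monomial (m + Finsupp.single j 1) a := by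
      rw [monomial_add_single, pow_one, mul_comm]
    rw [hX, apolar_monomial, apolar_monomial, coeff_pderiv]
    have h : (∏ i, (((m + Finsupp.single j 1 : σ →₀ ℕ) i)! : k)) = (m j + 1) * ∏ i, ((m i)! : k) := by
      rw [← Finset.mul_prod_erase _ _ (Finset.mem_univ j),
        ← Finset.mul_prod_erase _ (fun i => ((m i)! : k)) (Finset.mem_univ j), ← mul_assoc]
      congr 1
      · simp [Nat.factorial_succ]
      · refine Finset.prod_congr rfl fun i hi => ?_
        simp [(Finset.ne_of_mem_erase hi).symm]
    rw [h]
    ring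

/-- The linear form with coefficient vector `u`. -/
def linForm (u : σ → k) : MvPolynomial σ k := ∑ j, C (u j) * X j

/-- The substitution dual to a family `M` of coefficient vectors of linear forms. -/
def pullback (M : ρ → σ → k) : MvPolynomial σ k →ₐ[k] MvPolynomial ρ k :=
  aeval fun j => linForm fun r => M r j

theorem pderiv_linForm (u : σ → k) (j : σ) : pderiv j (linForm u) = C (u j) := by
  classical
  rw [linForm, map_sum, Finset.sum_eq_single j]
  · simp
  · intro i _ hi
    rw [pderiv_C_mul, pderiv_X_of_ne hi, mul_zero]
  · simp

theorem apolar_linForm_mul (u : σ → k) (G F : MvPolynomial σ k) :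
    apolar G (linForm u * F) = ∑ j, u j * apolar (pderiv j G) F := by
  rw [linForm, Finset.sum_mul, map_sum]
  refine Finset.sum_congr rfl fun j _ => ?_
  rw [mul_assoc, apolar_C_mul_right, apolar_X_mul]

theorem pderiv_pullback (M : ρ → σ → k) (r : ρ) (G : MvPolynomial σ k) :
    pderiv r (pullback M G) = ∑ j, C (M r j) * pullback M (pderiv j G) := by
  rw [pullback, pderiv_aeval]
  refine Finset.sum_congr rfl fun j _ => ?_
  rw [pderiv_linForm, mul_comm]

/-- Substituting linear forms into `A` is adjoint to restricting `G` to their span. This moves all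
questions about products of forms in a pencil to binary forms. -/
theorem apolar_aeval_linForm (M : ρ → σ → k) (A : MvPolynomial ρ k) (G : MvPolynomial σ k) :
    apolar G (aeval (fun r => linForm (M r)) A) = apolar (pullback M G) A := by
  induction A using MvPolynomial.induction_on generalizing G with
  | C a =>
    have h : coeff 0 (pullback M G) = coeff 0 G := by
      change constantCoeff (pullback M G) = constantCoeff G
      induction G using MvPolynomial.induction_on with
      | C b => simp [pullback]
      | add p q hp hq => rw [map_add, map_add, hp, hq, map_add]
      | mul_X p j hp =>
        rw [map_mul, map_mul, map_mul, constantCoeff_X, mul_zero]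
        simp [pullback, linForm]
    rw [aeval_C, algebraMap_eq, ← monomial_zero', ← monomial_zero', apolar_monomial,
      apolar_monomial, h]
    simp
  | add p q hp hq => rw [map_add, map_add, map_add, hp, hq]
  | mul_X p r hp =>
    rw [map_mul, aeval_X, mul_comm, apolar_linForm_mul, mul_comm, apolar_X_mul, pderiv_pullback,
      apolar_sum]
    refine Finset.sum_congr rfl fun j _ => ?_
    rw [apolar_C_mul, hp]

theorem eq_zero_of_apolar [CharZero k] {e : ℕ} {A : MvPolynomial (Fin 2) k} (hA : A.IsHomogeneous e)
    (h : ∀ p q, p + q = e → apolar (X 0 ^ p * X 1 ^ q) A = 0) : A = 0 := by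
  ext m
  rw [coeff_zero]
  by_cases hm : m.degree = e
  · have hm2 : m = Finsupp.single 0 (m 0) + Finsupp.single 1 (m 1) := by
      ext i
      fin_cases i <;> simp
    have hmon : (X 0 ^ m 0 * X 1 ^ m 1 : MvPolynomial (Fin 2) k) = monomial m 1 := by
      conv_rhs => rw [hm2]
      rw [X_pow_eq_monomial, X_pow_eq_monomial, monomial_mul, one_mul]
    have h1 := h (m 0) (m 1) (by rw [← hm, Finsupp.degree_eq_sum, Fin.sum_univ_two])
    rw [hmon, apolar_monomial_left] at h1
    refine (mul_eq_zero.mp h1).resolve_left (Finset.prod_ne_zero_iff.mpr fun j _ => ?_)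
    exact_mod_cast Nat.factorial_ne_zero _
  · exact hA.coeff_eq_zero hm

end Apolarity

/-! ### Independence of tangent vectors at products supported on separated lines. -/

section Tangent

open MvPolynomial

variable {k : Type*} [Field k]

/-- The linear form `X 0 - i X 1`. -/
def binLin (k : Type*) [Field k] (i : ℕ) : MvPolynomial (Fin 2) k := X 0 - C (i : k) * X 1

theorem binLin_isHomogeneous (i : ℕ) : (binLin k i).IsHomogeneous 1 :=
  (isHomogeneous_X _ _).sub (by simpa using (isHomogeneous_C (Fin 2) (i : k)).mul (isHomogeneous_X k 1))

theorem eval_binLin (i j : ℕ) : eval ![(j : k), 1] (binLin k i) = j - i := by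
  simp [binLin]

theorem eval_prod_erase_binLin_ne_zero [CharZero k] {d : ℕ} (i : Fin d) :
    eval ![((i : ℕ) : k), 1] (∏ i' ∈ Finset.univ.erase i, binLin k i') ≠ 0 := by
  rw [map_prod, Finset.prod_ne_zero_iff]
  intro i' hi'
  rw [eval_binLin, sub_ne_zero]
  intro h
  exact Finset.ne_of_mem_erase hi' (Fin.ext (by exact_mod_cast h.symm))

theorem eval_prod_erase_binLin_eq_zero {d : ℕ} {i i' : Fin d} (h : i' ≠ i) :
    eval ![((i : ℕ) : k), 1] (∏ i'' ∈ Finset.univ.erase i', binLin k i'') = 0 := by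
  rw [map_prod]
  exact Finset.prod_eq_zero (Finset.mem_erase.mpr ⟨h.symm, Finset.mem_univ i⟩)
    (by rw [eval_binLin, sub_self])

theorem eq_zero_of_sum_prod_erase_binLin [CharZero k] {d : ℕ} (e : Fin d → k)
    (h : ∑ i, C (e i) * ∏ i' ∈ Finset.univ.erase i, binLin k i' = 0) (i : Fin d) : e i = 0 := by
  have h1 := congrArg (eval ![((i : ℕ) : k), 1]) h
  rw [map_zero, map_sum, Finset.sum_eq_single i] at h1
  · rw [map_mul, eval_C] at h1
    exact (mul_eq_zero.mp h1).resolve_right (eval_prod_erase_binLin_ne_zero i)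
  · intro i' _ hi'
    rw [map_mul, eval_prod_erase_binLin_eq_zero hi', mul_zero]
  · simp

theorem prod_erase_binLin_isHomogeneous {d : ℕ} (i : Fin d) :
    (∏ i' ∈ Finset.univ.erase i, binLin k i').IsHomogeneous (d - 1) := by
  have := IsHomogeneous.prod (Finset.univ.erase i) (fun i' : Fin d => binLin k i') (fun _ => 1)
    (fun i' _ => binLin_isHomogeneous _)
  simpa using this

theorem prod_binLin_isHomogeneous (d : ℕ) :
    (∏ i : Fin d, binLin k i).IsHomogeneous d := by
  have := IsHomogeneous.prod Finset.univ (fun i' : Fin d => binLin k i') (fun _ => 1)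
    (fun i' _ => binLin_isHomogeneous _)
  simpa using this

variable {W : Type*} {n κ d : ℕ}

/-- The lines spanned by the rows of `M w` impose independent conditions on forms of degree `κ`,
in the form of dual bases. -/
def LinesSeparated (κ : ℕ) (M : W → Fin 2 → Fin (n + 1) → k) : Prop :=
  ∀ w, ∀ p q, p + q = κ → ∃ G : MvPolynomial (Fin (n + 1)) k,
    pullback (M w) G = X 0 ^ p * X 1 ^ q ∧ ∀ w', w' ≠ w → pullback (M w') G = 0

/-- The lines spanned by the rows of `M w` are graphs over the line of the first two coordinates. -/
def LinesNormalized (M : W → Fin 2 → Fin (n + 1) → k) : Prop :=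
  ∀ w, pullback (M w) (X 0) = X 0 ∧ pullback (M w) (X 1) = X 1

/-- The monomial is split into two factors of degree `κ` and a rest. The two separating forms for
these factors both vanish on the other lines, so by Leibniz their product vanishes there to second
order. Normalization allows the rest to be lifted as a monomial in the first two coordinates. -/
theorem LinesSeparated.exists_double {M : W → Fin 2 → Fin (n + 1) → k} (hS : LinesSeparated κ M)
    (hN : LinesNormalized M) (w : W) {p q : ℕ} (hpq : 2 * κ ≤ p + q) :
    ∃ G : MvPolynomial (Fin (n + 1)) k, pullback (M w) G = X 0 ^ p * X 1 ^ q ∧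
      ∀ w', w' ≠ w → pullback (M w') G = 0 ∧ ∀ j, pullback (M w') (pderiv j G) = 0 := by
  obtain ⟨p1, p2, p3, q1, q2, q3, hp, hq, h1, h2⟩ : ∃ p1 p2 p3 q1 q2 q3 : ℕ,
      p = p1 + p2 + p3 ∧ q = q1 + q2 + q3 ∧ p1 + q1 = κ ∧ p2 + q2 = κ := by
    refine ⟨min p κ, min (p - min p κ) κ, p - min p κ - min (p - min p κ) κ, κ - min p κ,
      κ - min (p - min p κ) κ, q - (κ - min p κ) - (κ - min (p - min p κ) κ), ?_⟩
    omega
  obtain ⟨G1, hG1, hG1'⟩ := hS w p1 q1 h1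
  obtain ⟨G2, hG2, hG2'⟩ := hS w p2 q2 h2
  refine ⟨G1 * G2 * (X 0 ^ p3 * X 1 ^ q3), ?_, fun w' hw' => ⟨?_, fun j => ?_⟩⟩
  · rw [map_mul, map_mul, map_mul, map_pow, map_pow, (hN w).1, (hN w).2, hG1, hG2, hp, hq]
    ring
  · rw [map_mul, map_mul, hG1' w' hw', zero_mul, zero_mul]
  · simp only [Derivation.leibniz, smul_eq_mul, map_add, map_mul, hG1' w' hw', hG2' w' hw']
    ring

/-- The tangent vectors, at products of distinct linear forms on the lines spanned by `M w`, to the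
family of scalar multiples of products of linear forms with constant coefficient at `X 0`. -/
theorem tangent_independent [CharZero k] [Fintype W] {M : W → Fin 2 → Fin (n + 2) → k}
    (hS : LinesSeparated κ M) (hN : LinesNormalized M) (hd : 2 * κ + 1 ≤ d)
    (c : W → k) (e : W → Fin d → Fin (n + 1) → k)
    (h : ∑ w, (C (c w) * aeval (fun r => linForm (M w r)) (∏ i : Fin d, binLin k i) +
      ∑ i, ∑ j, C (e w i j) * (X (Fin.succ j) * aeval (fun r => linForm (M w r))
        (∏ i' ∈ Finset.univ.erase i, binLin k i'))) = 0) (w : W) :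
    c w = 0 ∧ ∀ i j, e w i j = 0 := by
  classical
  obtain ⟨b, hb⟩ : ∃ b : MvPolynomial (Fin 2) k, b = ∏ i : Fin d, binLin k i := ⟨_, rfl⟩
  obtain ⟨bi, hbi⟩ : ∃ bi : Fin d → MvPolynomial (Fin 2) k,
    ∀ i, bi i = ∏ i' ∈ Finset.univ.erase i, binLin k i' := ⟨_, fun _ => rfl⟩
  simp only [← hb, ← hbi] at h
  have hbh : b.IsHomogeneous d := hb ▸ prod_binLin_isHomogeneous d
  have hbih : ∀ i, (bi i).IsHomogeneous (d - 1) := fun i =>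
    hbi i ▸ prod_erase_binLin_isHomogeneous i
  have key : ∀ G : MvPolynomial (Fin (n + 2)) k,
      (∀ w', w' ≠ w → pullback (M w') G = 0 ∧ ∀ j, pullback (M w') (pderiv j G) = 0) →
      c w * apolar (pullback (M w) G) b +
        ∑ i, ∑ j, e w i j * apolar (pullback (M w) (pderiv (Fin.succ j) G)) (bi i) = 0 := by
    intro G hG
    have h1 := congrArg (apolar G) h
    rw [map_zero, map_sum, Finset.sum_eq_single w] at h1
    · rw [← h1, map_add, apolar_C_mul_right, apolar_aeval_linForm, map_sum]
      congr 1
      refine Finset.sum_congr rfl fun i _ => ?_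
      rw [map_sum]
      refine Finset.sum_congr rfl fun j _ => ?_
      rw [apolar_C_mul_right, apolar_X_mul, apolar_aeval_linForm]
    · intro w' _ hw'
      rw [map_add, apolar_C_mul_right, apolar_aeval_linForm, (hG w' hw').1, apolar_zero, mul_zero,
        zero_add, map_sum]
      refine Finset.sum_eq_zero fun i _ => ?_
      rw [map_sum]
      refine Finset.sum_eq_zero fun j _ => ?_
      rw [apolar_C_mul_right, apolar_X_mul, apolar_aeval_linForm, (hG w' hw').2, apolar_zero,
        mul_zero]
    · simp
  have hM0 : M w 0 0 = 1 ∧ M w 1 0 = 0 ∧ M w 0 1 = 0 ∧ M w 1 1 = 1 := by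
    have h0 := (hN w).1
    have h1 := (hN w).2
    simp only [pullback, aeval_X, linForm, Fin.sum_univ_two] at h0 h1
    have e1 := congrArg (eval ![1, 0]) h0
    have e2 := congrArg (eval ![0, 1]) h0
    have e3 := congrArg (eval ![1, 0]) h1
    have e4 := congrArg (eval ![0, 1]) h1
    simp at e1 e2 e3 e4
    exact ⟨e1, e2, e3, e4⟩
  -- the normal directions
  have normal : ∀ j : Fin (n + 1),
      ∑ i, C (e w i j - M w 1 j.succ * e w i 0) * bi i = 0 := by
    intro j
    by_cases hj : j = 0
    · subst hj
      refine Finset.sum_eq_zero fun i _ => ?_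
      have : M w 1 (Fin.succ 0) = 1 := hM0.2.2.2
      rw [this]
      simp
    refine eq_zero_of_apolar (e := d - 1) (IsHomogeneous.sum _ _ _ fun i _ => ?_)
      fun p q hpq => ?_
    · exact (zero_add (d - 1)) ▸ (isHomogeneous_C (Fin 2) _).mul (hbih i)
    obtain ⟨G, hG1, hG2⟩ := hS.exists_double hN w (p := p) (q := q) (by omega)
    -- `H` is an equation of the line `L_w`. In `G * H` the value on `L_w` is zero and only the
    -- derivative of `H` survives, which picks out one normal direction.
    set H : MvPolynomial (Fin (n + 2)) k :=
      X j.succ - C (M w 0 j.succ) * X 0 - C (M w 1 j.succ) * X 1 with hH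
    have hH0 : pullback (M w) H = 0 := by
      rw [hH, map_sub, map_sub, map_mul, map_mul, (hN w).1, (hN w).2]
      simp [pullback, linForm, Fin.sum_univ_two]
    have hHd : ∀ m : Fin (n + 1), pderiv m.succ H =
        C ((if m = j then 1 else 0) - (if m = 0 then M w 1 j.succ else 0)) := by
      intro m
      rw [hH, map_sub, map_sub, pderiv_C_mul, pderiv_C_mul, pderiv_X_of_ne (Fin.succ_ne_zero m).symm]
      have h1 : pderiv m.succ (X j.succ : MvPolynomial (Fin (n + 2)) k) =
          C (if m = j then 1 else 0) := by
        by_cases hm : m = j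
        · subst hm; simp
        · rw [pderiv_X_of_ne (fun h => hm (Fin.succ_injective _ h).symm)]; simp [hm]
      have h2 : pderiv m.succ (X 1 : MvPolynomial (Fin (n + 2)) k) =
          C (if m = 0 then 1 else 0) := by
        by_cases hm : m = 0
        · subst hm
          exact (pderiv_X_self _).trans (by simp)
        · exact (pderiv_X_of_ne (fun h => hm (Fin.succ_injective _
            (h.symm.trans Fin.succ_zero_eq_one.symm)))).trans (by simp [hm])
      rw [h1, h2, mul_zero, sub_zero, ← C_mul, ← C_sub]
      simp
    have h1 := key (G * H) (fun w' hw' => by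
      refine ⟨by rw [map_mul, (hG2 w' hw').1, zero_mul], fun m => ?_⟩
      rw [Derivation.leibniz, map_add, smul_eq_mul, smul_eq_mul, map_mul, map_mul,
        (hG2 w' hw').1, (hG2 w' hw').2]
      ring)
    rw [map_mul, hH0, mul_zero, apolar_zero, mul_zero, zero_add] at h1
    rw [map_sum, ← h1]
    refine Finset.sum_congr rfl fun i _ => ?_
    have h2 : ∀ m : Fin (n + 1), pullback (M w) (pderiv m.succ (G * H)) =
        C ((if m = j then 1 else 0) - (if m = 0 then M w 1 j.succ else 0)) *
          (X 0 ^ p * X 1 ^ q) := by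
      intro m
      rw [Derivation.leibniz, smul_eq_mul, smul_eq_mul, map_add, map_mul, map_mul, hH0, hHd, hG1]
      simp [pullback, mul_comm]
    simp only [h2, apolar_C_mul]
    rw [apolar_C_mul_right]
    simp only [sub_mul, mul_sub, Finset.sum_sub_distrib, ite_mul, mul_ite, one_mul, zero_mul,
      mul_zero, Finset.sum_ite_eq', Finset.mem_univ, if_true]
    ring
  -- the direction of the line
  have tangential : C (c w) * b + ∑ i, C (e w i 0) * (X 1 * bi i) = 0 := by
    refine eq_zero_of_apolar (e := d) (IsHomogeneous.add ?_ (IsHomogeneous.sum _ _ _ fun i _ => ?_))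
      fun p q hpq => ?_
    · exact (zero_add d) ▸ (isHomogeneous_C (Fin 2) _).mul hbh
    · have := (isHomogeneous_C (Fin 2) (e w i 0)).mul
        ((isHomogeneous_X k (1 : Fin 2)).mul (hbih i))
      have hd' : 0 + (1 + (d - 1)) = d := by omega
      rwa [hd'] at this
    obtain ⟨G, hG1, hG2⟩ := hS.exists_double hN w (p := p) (q := q) (by omega)
    have h1 := key G hG2
    rw [hG1] at h1
    rw [map_add, apolar_C_mul_right, ← h1, map_sum]
    congr 1
    rw [Finset.sum_comm]
    -- The relations `normal` replace every `e w i j` by `M w 1 j.succ * e w i 0`. The chain rule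
    -- then collects the derivatives of `G` into the derivative of its restriction along the second
    -- coordinate of the line.
    have h2 : ∀ j : Fin (n + 1), ∑ i, e w i j * apolar (pullback (M w) (pderiv j.succ G)) (bi i) =
        ∑ i, M w 1 j.succ * e w i 0 * apolar (pullback (M w) (pderiv j.succ G)) (bi i) := by
      intro j
      have h3 := congrArg (apolar (pullback (M w) (pderiv j.succ G))) (normal j)
      rw [map_zero, map_sum] at h3
      simp only [apolar_C_mul_right, sub_mul, Finset.sum_sub_distrib] at h3
      exact sub_eq_zero.mp h3
    rw [Finset.sum_congr rfl fun j _ => h2 j, Finset.sum_comm]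
    refine Finset.sum_congr rfl fun i _ => ?_
    rw [apolar_C_mul_right, apolar_X_mul, ← hG1, pderiv_pullback, Fin.sum_univ_succ, hM0.2.1,
      C_0, zero_mul, zero_add, apolar_sum, Finset.mul_sum]
    refine Finset.sum_congr rfl fun j _ => ?_
    rw [apolar_C_mul]
    ring
  -- At the `i`-th root, `b` and all cofactors except the `i`-th vanish.
  have he0 : ∀ i, e w i 0 = 0 := by
    intro i
    have h1 := congrArg (eval ![((i : ℕ) : k), 1]) tangential
    have hb0 : eval ![((i : ℕ) : k), 1] b = 0 := by
      rw [hb, map_prod]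
      exact Finset.prod_eq_zero (Finset.mem_univ i) (by rw [eval_binLin, sub_self])
    rw [map_zero, map_add, map_mul, hb0, mul_zero, zero_add, map_sum, Finset.sum_eq_single i] at h1
    · rw [map_mul, map_mul, eval_C, eval_X, hbi i] at h1
      exact (mul_eq_zero.mp h1).resolve_right
        (mul_ne_zero (by simp) (eval_prod_erase_binLin_ne_zero i))
    · intro i' _ hi'
      rw [map_mul, map_mul, hbi i', eval_prod_erase_binLin_eq_zero hi', mul_zero, mul_zero]
    · simp
  refine ⟨?_, fun i j => ?_⟩
  · simp only [he0, C_0, zero_mul, Finset.sum_const_zero, add_zero] at tangential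
    have hb0 : b ≠ 0 := by
      rw [hb, Finset.prod_ne_zero_iff]
      intro i _ h0
      have := congrArg (eval ![((i : ℕ) + 1 : k), 1]) h0
      simp [binLin] at this
    simpa using (mul_eq_zero.mp tangential).resolve_right hb0
  · have h1 := normal j
    simp only [he0, mul_zero, sub_zero, hbi] at h1
    exact eq_zero_of_sum_prod_erase_binLin _ h1 i

end Tangent

/-! ### An explicit family of lines imposing independent conditions. -/

section Lines

open MvPolynomial

variable {k : Type*} [Field k] {n r : ℕ}

/-- The coordinates of the points `(1 : 0)` and `(0 : 1)` of the line
`(u, v, u p₀, v p₁, u p₁ + v p₀, u p₂, v p₂, u p₃, v p₃, …)`. -/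
def lineRow (p : ℕ → k) : Fin 2 → ℕ → k
  | 0, 0 => 1
  | 0, 1 => 0
  | 0, 2 => p 0
  | 0, 3 => 0
  | 0, 4 => p 1
  | 0, m + 5 => if m % 2 = 0 then p (m / 2 + 2) else 0
  | 1, 0 => 0
  | 1, 1 => 1
  | 1, 2 => 0
  | 1, 3 => p 1
  | 1, 4 => p 0
  | 1, m + 5 => if m % 2 = 0 then 0 else p (m / 2 + 2)

/-- The line with parameter `p` in `ℙ^n`. -/
def lineMatrix (n : ℕ) (p : ℕ → k) : Fin 2 → Fin (n + 1) → k := fun r j => lineRow p r j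

theorem pullback_lineMatrix_X (p : ℕ → k) (j : Fin (n + 1)) :
    pullback (lineMatrix n p) (X j) = C (lineRow p 0 j) * X 0 + C (lineRow p 1 j) * X 1 := by
  rw [pullback, aeval_X, linForm, Fin.sum_univ_two]
  rfl

/-- The polynomial `h` in the parameters occurs with all monomials of degree `e + 1` on the lines
as a restriction of a form. -/
def Attained (n e : ℕ) (h : MvPolynomial (Fin r) k) : Prop :=
  ∀ i j, i + j = e + 1 → ∃ G : MvPolynomial (Fin (n + 1)) k, ∀ p : ℕ → k,
    pullback (lineMatrix n p) G = C (eval (fun t : Fin r => p t) h) * (X 0 ^ i * X 1 ^ j)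

theorem Attained.zero (e : ℕ) : Attained n e (0 : MvPolynomial (Fin r) k) :=
  fun i j _ => ⟨0, fun p => by simp⟩

theorem Attained.add {e : ℕ} {g h : MvPolynomial (Fin r) k} (hg : Attained n e g)
    (hh : Attained n e h) : Attained n e (g + h) := by
  intro i j hij
  obtain ⟨G, hG⟩ := hg i j hij
  obtain ⟨H, hH⟩ := hh i j hij
  exact ⟨G + H, fun p => by rw [map_add, hG, hH, map_add, C_add, add_mul]⟩

theorem Attained.C_mul {e : ℕ} {h : MvPolynomial (Fin r) k} (a : k)
    (hh : Attained n e h) : Attained n e (C a * h) := by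
  intro i j hij
  obtain ⟨H, hH⟩ := hh i j hij
  refine ⟨C a * H, fun p => ?_⟩
  rw [map_mul, hH, map_mul, eval_C, MvPolynomial.C_mul, ← mul_assoc]
  simp [pullback]

theorem pullback_lineMatrix_X_zero (hn : 4 ≤ n) (p : ℕ → k) :
    pullback (lineMatrix n p) (X ⟨0, by omega⟩) = X 0 := by
  rw [pullback_lineMatrix_X]; simp [lineRow]

theorem pullback_lineMatrix_X_one (hn : 4 ≤ n) (p : ℕ → k) :
    pullback (lineMatrix n p) (X ⟨1, by omega⟩) = X 1 := by
  rw [pullback_lineMatrix_X]; simp [lineRow]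

theorem pullback_lineMatrix_X_four (hn : 4 ≤ n) (p : ℕ → k) :
    pullback (lineMatrix n p) (X ⟨4, by omega⟩) = C (p 1) * X 0 + C (p 0) * X 1 := by
  rw [pullback_lineMatrix_X]; simp [lineRow]

theorem exists_pullback_eq_mul_X_zero (hn : 4 ≤ n) (hr : 2 * r ≤ n) (t : Fin r)
    (ht : (t : ℕ) ≠ 1) : ∃ j : Fin (n + 1), ∀ p : ℕ → k,
      pullback (lineMatrix n p) (X j) = C (p t) * X 0 := by
  obtain ⟨t, htr⟩ := t
  rcases t with _ | _ | t
  · exact ⟨⟨2, by omega⟩, fun p => by rw [pullback_lineMatrix_X]; simp [lineRow]⟩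
  · simp at ht
  · refine ⟨⟨2 * t + 5, by omega⟩, fun p => ?_⟩
    rw [pullback_lineMatrix_X]
    simp [lineRow]

theorem exists_pullback_eq_mul_X_one (hn : 4 ≤ n) (hr : 2 * r ≤ n) (t : Fin r)
    (ht : (t : ℕ) ≠ 0) : ∃ j : Fin (n + 1), ∀ p : ℕ → k,
      pullback (lineMatrix n p) (X j) = C (p t) * X 1 := by
  obtain ⟨t, htr⟩ := t
  rcases t with _ | _ | t
  · simp at ht
  · exact ⟨⟨3, by omega⟩, fun p => by rw [pullback_lineMatrix_X]; simp [lineRow]⟩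
  · refine ⟨⟨2 * t + 1 + 5, by omega⟩, fun p => ?_⟩
    rw [pullback_lineMatrix_X]
    have h1 : (2 * t + 1) % 2 = 1 := by omega
    have h2 : (2 * t + 1) / 2 = t := by omega
    simp [lineRow, h1, h2]

theorem eval_monomial_add_single (m : Fin r →₀ ℕ) (t : Fin r) (x : Fin r → k) :
    eval x (monomial (m + Finsupp.single t 1) (1 : k)) = eval x (monomial m 1) * x t := by
  rw [monomial_add_single, pow_one, map_mul, eval_X]

theorem exists_eq_add_single {m : Fin r →₀ ℕ} {t : Fin r} (h : m t ≠ 0) :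
    ∃ m' : Fin r →₀ ℕ, m = m' + Finsupp.single t 1 :=
  ⟨m - Finsupp.single t 1, (tsub_add_cancel_of_le
    (Finsupp.single_le_iff.mpr (Nat.one_le_iff_ne_zero.mpr h))).symm⟩

/-- Induction on `e`, multiplying by a coordinate that restricts to `p_t u` or `p_t v`. The family
has neither `p_1 u` nor `p_0 v` as a coordinate, only the sum `u p_1 + v p_0`; this economy is what
allows `r = ⌊n/2⌋` parameters. The spare degree in `e + 1` makes the sum sufficient. -/
theorem attained_monomial (hn : 4 ≤ n) (hr : 2 * r ≤ n) (hr2 : 2 ≤ r) (e : ℕ) (m : Fin r →₀ ℕ)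
    (hm : m.degree ≤ e) : Attained n e (monomial m (1 : k)) := by
  induction e generalizing m with
  | zero =>
    intro i j _
    have hm0 : m = 0 := (Finsupp.degree_eq_zero_iff m).mp (Nat.le_zero.mp hm)
    refine ⟨X ⟨0, by omega⟩ ^ i * X ⟨1, by omega⟩ ^ j, fun p => ?_⟩
    rw [map_mul, map_pow, map_pow, pullback_lineMatrix_X_zero hn, pullback_lineMatrix_X_one hn, hm0]
    simp
  | succ e ih =>
    intro i j hij
    by_cases hme : m.degree ≤ e
    · rcases i with _ | i
      · obtain ⟨G, hG⟩ := ih m hme 0 (e + 1) (by omega)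
        refine ⟨X ⟨1, by omega⟩ * G, fun p => ?_⟩
        rw [map_mul, hG, pullback_lineMatrix_X_one hn]
        obtain rfl : j = e + 1 + 1 := by omega
        ring
      · obtain ⟨G, hG⟩ := ih m hme i j (by omega)
        refine ⟨X ⟨0, by omega⟩ * G, fun p => ?_⟩
        rw [map_mul, hG, pullback_lineMatrix_X_zero hn]
        ring
    have stepu : ∀ (m' : Fin r →₀ ℕ) (t : Fin r) (i j : ℕ), m'.degree ≤ e → (t : ℕ) ≠ 1 →
        i + j = e + 1 → ∃ G : MvPolynomial (Fin (n + 1)) k, ∀ p : ℕ → k,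
        pullback (lineMatrix n p) G = C (eval (fun t : Fin r => p t)
          (monomial (m' + Finsupp.single t 1) 1)) * (X 0 ^ (i + 1) * X 1 ^ j) := by
      intro m' t i j hm' ht hij
      obtain ⟨G, hG⟩ := ih m' hm' i j hij
      obtain ⟨l, hl⟩ := exists_pullback_eq_mul_X_zero (k := k) hn hr t ht
      refine ⟨X l * G, fun p => ?_⟩
      rw [map_mul, hG, hl, eval_monomial_add_single, MvPolynomial.C_mul]
      ring
    have stepv : ∀ (m' : Fin r →₀ ℕ) (t : Fin r) (i j : ℕ), m'.degree ≤ e → (t : ℕ) ≠ 0 →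
        i + j = e + 1 → ∃ G : MvPolynomial (Fin (n + 1)) k, ∀ p : ℕ → k,
        pullback (lineMatrix n p) G = C (eval (fun t : Fin r => p t)
          (monomial (m' + Finsupp.single t 1) 1)) * (X 0 ^ i * X 1 ^ (j + 1)) := by
      intro m' t i j hm' ht hij
      obtain ⟨G, hG⟩ := ih m' hm' i j hij
      obtain ⟨l, hl⟩ := exists_pullback_eq_mul_X_one (k := k) hn hr t ht
      refine ⟨X l * G, fun p => ?_⟩
      rw [map_mul, hG, hl, eval_monomial_add_single, MvPolynomial.C_mul]
      ring
    obtain ⟨t, ht⟩ : ∃ t, m t ≠ 0 := by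
      by_contra! h0
      have : m = 0 := Finsupp.ext h0
      rw [this] at hme
      simp at hme
    obtain ⟨m', rfl⟩ := exists_eq_add_single ht
    have hm' : m'.degree ≤ e := by
      rw [map_add, Finsupp.degree_single] at hm
      omega
    rcases i with _ | i
    · obtain rfl : j = e + 1 + 1 := by omega
      -- The target is `p_0 v^(e+2)` times a monomial. It is obtained as `(u p_1 + v p_0) v^(e+1) -
      -- (p_1 v) (u v^e)`, where the last product is available because `p_1 v` is a coordinate. The
      -- mirror image, with `p_1 u^(e+2)`, occurs below.
      by_cases ht0 : (t : ℕ) = 0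
      · obtain ⟨G, hG⟩ := ih m' hm' 0 (e + 1) (by omega)
        obtain ⟨H, hH⟩ := stepv m' ⟨1, by omega⟩ 1 e hm' one_ne_zero (by omega)
        refine ⟨X ⟨4, by omega⟩ * G - H, fun p => ?_⟩
        rw [map_sub, map_mul, hG, hH, pullback_lineMatrix_X_four hn, eval_monomial_add_single,
          eval_monomial_add_single, MvPolynomial.C_mul, MvPolynomial.C_mul, ht0]
        ring
      · exact stepv m' t 0 (e + 1) hm' ht0 (by omega)
    · by_cases ht1 : (t : ℕ) = 1
      · rcases j with _ | j
        · obtain rfl : i = e + 1 := by omega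
          obtain ⟨G, hG⟩ := ih m' hm' (e + 1) 0 (by omega)
          obtain ⟨H, hH⟩ := stepu m' ⟨0, by omega⟩ e 1 hm' zero_ne_one (by omega)
          refine ⟨X ⟨4, by omega⟩ * G - H, fun p => ?_⟩
          rw [map_sub, map_mul, hG, hH, pullback_lineMatrix_X_four hn, eval_monomial_add_single,
            eval_monomial_add_single, MvPolynomial.C_mul, MvPolynomial.C_mul, ht1]
          ring
        · exact stepv m' t (i + 1) j hm' (by omega) (by omega)
      · exact stepu m' t i j hm' ht1 (by omega)

theorem attained_of_totalDegree_le (hn : 4 ≤ n) (hr : 2 * r ≤ n) (hr2 : 2 ≤ r) (e : ℕ)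
    (h : MvPolynomial (Fin r) k) (hh : h.totalDegree ≤ e) : Attained n e h := by
  rw [h.as_sum]
  refine Finset.sum_induction _ (Attained n e) (fun _ _ => Attained.add) (Attained.zero e)
    fun m hm => ?_
  have : monomial m (coeff m h) = C (coeff m h) * monomial m 1 := by
    rw [C_mul_monomial, mul_one]
  rw [this]
  refine (attained_monomial hn hr hr2 e m ?_).C_mul _
  exact (le_totalDegree hm).trans hh

/-- The parameters of the lines: the lattice points of a simplex. -/
def simplexPoint (k : Type*) [Field k] {r : ℕ} (w : Fin (r + 1) →₀ ℕ) : ℕ → k :=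
  fun t => if h : t < r + 1 then (w ⟨t, h⟩ : k) else 0

/-- The barycentric coordinates of the simplex of size `e`. -/
def barycentric (k : Type*) [Field k] (r e : ℕ) : Fin (r + 1) → MvPolynomial (Fin r) k :=
  Fin.snoc (fun t => X t) (C (e : k) - ∑ t, X t)

theorem totalDegree_barycentric_le (e : ℕ) (t : Fin (r + 1)) :
    (barycentric k r e t).totalDegree ≤ 1 := by
  induction t using Fin.lastCases with
  | last =>
    rw [barycentric, Fin.snoc_last]
    refine (totalDegree_sub _ _).trans (max_le (by rw [totalDegree_C]; exact zero_le_one) ?_)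
    exact totalDegree_finsetSum_le fun t _ => (totalDegree_X (R := k) t).le
  | cast t =>
    rw [barycentric, Fin.snoc_castSucc]
    exact (totalDegree_X t).le

theorem eval_barycentric {e : ℕ} {w : Fin (r + 1) →₀ ℕ}
    (hw : w ∈ Finset.finsuppAntidiag (Finset.univ : Finset (Fin (r + 1))) e) (t : Fin (r + 1)) :
    eval (fun t : Fin r => simplexPoint k w t) (barycentric k r e t) = w t := by
  have hval : ∀ t : Fin r, simplexPoint k w t = w t.castSucc := fun t => by
    rw [simplexPoint, dif_pos (by omega)]
    rfl
  induction t using Fin.lastCases with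
  | last =>
    rw [barycentric, Fin.snoc_last, map_sub, eval_C, map_sum]
    simp only [eval_X, hval]
    have h := (Finset.mem_finsuppAntidiag.mp hw).1
    rw [Fin.sum_univ_castSucc] at h
    rw [← h]
    push_cast
    ring
  | cast t => rw [barycentric, Fin.snoc_castSucc, eval_X, hval]

/-- The numerator of the Lagrange interpolation polynomial of a lattice point of a simplex. -/
def lagrangeNumerator (k : Type*) [Field k] {r : ℕ} (e : ℕ) (w : Fin (r + 1) →₀ ℕ) :
    MvPolynomial (Fin r) k :=
  ∏ t, ∏ i ∈ Finset.range (w t), (barycentric k r e t - C (i : k))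

theorem totalDegree_lagrangeNumerator_le {e : ℕ} {w : Fin (r + 1) →₀ ℕ}
    (hw : w ∈ Finset.finsuppAntidiag (Finset.univ : Finset (Fin (r + 1))) e) :
    (lagrangeNumerator k e w).totalDegree ≤ e := by
  refine (totalDegree_finsetProd _ _).trans
    ((Finset.sum_le_sum fun t _ => ?_).trans (Finset.mem_finsuppAntidiag.mp hw).1.le)
  refine (totalDegree_finsetProd _ _).trans ?_
  refine (Finset.sum_le_card_nsmul _ _ 1 fun i _ => ?_).trans (by simp)
  exact (totalDegree_sub _ _).trans (max_le (totalDegree_barycentric_le e t)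
    (by rw [totalDegree_C]; exact zero_le_one))

theorem eval_lagrangeNumerator {e : ℕ} (w : Fin (r + 1) →₀ ℕ) {w' : Fin (r + 1) →₀ ℕ}
    (hw' : w' ∈ Finset.finsuppAntidiag (Finset.univ : Finset (Fin (r + 1))) e) :
    eval (fun t : Fin r => simplexPoint k w' t) (lagrangeNumerator k e w) =
      ∏ t, ∏ i ∈ Finset.range (w t), ((w' t : k) - i) := by
  simp only [lagrangeNumerator, map_prod, map_sub, eval_barycentric hw', eval_C]

theorem eval_lagrangeNumerator_self_ne_zero [CharZero k] {e : ℕ} {w : Fin (r + 1) →₀ ℕ}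
    (hw : w ∈ Finset.finsuppAntidiag (Finset.univ : Finset (Fin (r + 1))) e) :
    eval (fun t : Fin r => simplexPoint k w t) (lagrangeNumerator k e w) ≠ 0 := by
  rw [eval_lagrangeNumerator w hw]
  refine Finset.prod_ne_zero_iff.mpr fun t _ => Finset.prod_ne_zero_iff.mpr fun i hi => ?_
  rw [sub_ne_zero]
  exact_mod_cast (Finset.mem_range.mp hi).ne'

/-- Two distinct lattice points have the same coordinate sum, so some coordinate of `w'` is smaller
than that of `w`, and this integer is among the roots in the numerator. -/
theorem eval_lagrangeNumerator_eq_zero {e : ℕ} {w w' : Fin (r + 1) →₀ ℕ}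
    (hw : w ∈ Finset.finsuppAntidiag (Finset.univ : Finset (Fin (r + 1))) e)
    (hw' : w' ∈ Finset.finsuppAntidiag (Finset.univ : Finset (Fin (r + 1))) e) (hne : w' ≠ w) :
    eval (fun t : Fin r => simplexPoint k w' t) (lagrangeNumerator k e w) = 0 := by
  rw [eval_lagrangeNumerator w hw']
  obtain ⟨t, ht⟩ : ∃ t, w' t < w t := by
    by_contra! h
    refine hne (Finsupp.ext fun t => ?_)
    refine (((Finset.sum_eq_sum_iff_of_le fun t _ => h t).mp ?_) t (Finset.mem_univ t)).symm
    rw [(Finset.mem_finsuppAntidiag.mp hw).1, (Finset.mem_finsuppAntidiag.mp hw').1]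
  refine Finset.prod_eq_zero (Finset.mem_univ t)
    (Finset.prod_eq_zero (Finset.mem_range.mpr ht) (sub_self _))

/-- The lattice points of a simplex, as indices of a family of lines. -/
abbrev SimplexIndex (r e : ℕ) : Type :=
  {w : Fin (r + 1) →₀ ℕ // w ∈ Finset.finsuppAntidiag (Finset.univ : Finset (Fin (r + 1))) e}

theorem card_simplexIndex (r e : ℕ) : Fintype.card (SimplexIndex r e) = (e + r).choose r := by
  rw [Fintype.card_coe, Finset.card_finsuppAntidiag_nat_eq_choose, Finset.card_univ,
    Fintype.card_fin, show r + 1 + e - 1 = e + r by omega, Nat.choose_symm_add]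

theorem linesSeparated_simplex [CharZero k] (hn : 4 ≤ n) (hr : 2 * r ≤ n) (hr2 : 2 ≤ r) (e : ℕ) :
    LinesSeparated (e + 1) fun w : SimplexIndex r e => lineMatrix n (simplexPoint k w.1) := by
  intro w i j hij
  obtain ⟨G, hG⟩ := attained_of_totalDegree_le hn hr hr2 e _
    (totalDegree_lagrangeNumerator_le (k := k) w.2) i j hij
  have h0 := eval_lagrangeNumerator_self_ne_zero (k := k) w.2
  refine ⟨C (eval (fun t : Fin r => simplexPoint k w.1 t) (lagrangeNumerator k e w.1))⁻¹ * G,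
    ?_, fun w' hw' => ?_⟩
  · rw [map_mul, hG, ← mul_assoc]
    have : pullback (lineMatrix n (simplexPoint k w.1))
        (C (eval (fun t : Fin r => simplexPoint k w.1 t) (lagrangeNumerator k e w.1))⁻¹) =
        C (eval (fun t : Fin r => simplexPoint k w.1 t) (lagrangeNumerator k e w.1))⁻¹ := by
      simp [pullback]
    rw [this, ← MvPolynomial.C_mul, inv_mul_cancel₀ h0, C_1, one_mul]
  · rw [map_mul, hG, eval_lagrangeNumerator_eq_zero w.2 w'.2 (fun h => hw' (Subtype.ext h)), C_0,
      zero_mul, mul_zero]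

end Lines

/-! ### The parametrization of sums of products and its derivative. -/

section Parametrization

open MvPolynomial

variable {k : Type*} [Field k]

/-- `F₀` is the value at `x`, and `F₁` the derivative at `x` in the direction of the variable `t`, of
the polynomial `F` whose coefficients are polynomials in the parameters `τ`. -/
def HasCoeffDeriv {τ σ : Type*} (x : τ → k) (t : τ) (F : MvPolynomial σ (MvPolynomial τ k))
    (F₀ F₁ : MvPolynomial σ k) : Prop :=
  ∀ m, eval x (coeff m F) = coeff m F₀ ∧ eval x (pderiv t (coeff m F)) = coeff m F₁

section HasCoeffDeriv

variable {τ σ : Type*} {x : τ → k} {t : τ} {F G : MvPolynomial σ (MvPolynomial τ k)}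
  {F₀ F₁ G₀ G₁ : MvPolynomial σ k}

theorem HasCoeffDeriv.add (hF : HasCoeffDeriv x t F F₀ F₁) (hG : HasCoeffDeriv x t G G₀ G₁) :
    HasCoeffDeriv x t (F + G) (F₀ + G₀) (F₁ + G₁) := fun m => by
  simp only [coeff_add, map_add, (hF m).1, (hF m).2, (hG m).1, (hG m).2, and_self]

theorem HasCoeffDeriv.mul (hF : HasCoeffDeriv x t F F₀ F₁) (hG : HasCoeffDeriv x t G G₀ G₁) :
    HasCoeffDeriv x t (F * G) (F₀ * G₀) (F₀ * G₁ + F₁ * G₀) := by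
  classical
  intro m
  rw [coeff_mul, coeff_add, coeff_mul, coeff_mul, coeff_mul, map_sum, map_sum, map_sum,
    ← Finset.sum_add_distrib]
  refine ⟨Finset.sum_congr rfl fun i _ => ?_, Finset.sum_congr rfl fun i _ => ?_⟩
  · rw [map_mul, (hF _).1, (hG _).1]
  · rw [Derivation.leibniz, map_add, smul_eq_mul, smul_eq_mul, map_mul, map_mul, (hF _).1, (hG _).1,
      (hF _).2, (hG _).2]
    ring

theorem hasCoeffDeriv_C (Q : MvPolynomial τ k) :
    HasCoeffDeriv x t (C Q : MvPolynomial σ _) (C (eval x Q)) (C (eval x (pderiv t Q))) := by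
  classical
  intro m
  simp only [coeff_C]
  split_ifs <;> simp

theorem hasCoeffDeriv_X (j : σ) :
    HasCoeffDeriv x t (X j : MvPolynomial σ (MvPolynomial τ k)) (X j) 0 := by
  classical
  intro m
  simp only [coeff_X, coeff_zero]
  split_ifs <;> simp

theorem hasCoeffDeriv_sum {ι : Type*} (s : Finset ι) {F : ι → MvPolynomial σ (MvPolynomial τ k)}
    {F₀ F₁ : ι → MvPolynomial σ k} (h : ∀ i ∈ s, HasCoeffDeriv x t (F i) (F₀ i) (F₁ i)) :
    HasCoeffDeriv x t (∑ i ∈ s, F i) (∑ i ∈ s, F₀ i) (∑ i ∈ s, F₁ i) := by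
  intro m
  simp only [coeff_sum, map_sum]
  exact ⟨Finset.sum_congr rfl fun i hi => (h i hi m).1,
    Finset.sum_congr rfl fun i hi => (h i hi m).2⟩

theorem hasCoeffDeriv_prod {ι : Type*} [DecidableEq ι] (s : Finset ι)
    {F : ι → MvPolynomial σ (MvPolynomial τ k)}
    {F₀ F₁ : ι → MvPolynomial σ k} (h : ∀ i ∈ s, HasCoeffDeriv x t (F i) (F₀ i) (F₁ i)) :
    HasCoeffDeriv x t (∏ i ∈ s, F i) (∏ i ∈ s, F₀ i)
      (∑ i ∈ s, F₁ i * ∏ i' ∈ s.erase i, F₀ i') := by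
  induction s using Finset.induction_on with
  | empty => simpa using hasCoeffDeriv_C (x := x) (t := t) (σ := σ) (1 : MvPolynomial τ k)
  | insert a s ha ih =>
    have h1 := (h a (Finset.mem_insert_self a s)).mul
      (ih fun i hi => h i (Finset.mem_insert_of_mem hi))
    rw [Finset.prod_insert ha, Finset.prod_insert ha, Finset.sum_insert ha,
      Finset.erase_insert ha, add_comm]
    convert h1 using 2
    rw [Finset.mul_sum]
    refine Finset.sum_congr rfl fun i hi => ?_
    have hai : a ≠ i := fun h => ha (h ▸ hi)
    rw [Finset.erase_insert_of_ne hai, Finset.prod_insert (fun h => ha (Finset.mem_of_mem_erase h))]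
    ring

end HasCoeffDeriv

variable {n d : ℕ} {W : Type*}

/-- The linear form with coefficient `1` at `X 0` and coefficients `a` at the other variables. -/
def unitForm {R : Type*} [CommRing R] (a : Fin n → R) : MvPolynomial (Fin (n + 1)) R :=
  X 0 + ∑ j, C (a j) * X (Fin.succ j)

/-- The parameters of a sum of scalar multiples of products of linear forms. -/
abbrev Param (W : Type*) (n d : ℕ) : Type _ := W × Option (Fin d × Fin n)

/-- The sum, over `w`, of a scalar multiple of a product of linear forms with coefficient `1` at
`X 0`. -/
def sumOfSplit {R : Type*} [CommRing R] [Fintype W] (x : Param W n d → R) :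
    MvPolynomial (Fin (n + 1)) R :=
  ∑ w, C (x (w, none)) * ∏ i, unitForm fun j => x (w, some (i, j))

theorem map_sumOfSplit {R S : Type*} [CommRing R] [CommRing S] [Fintype W] (f : R →+* S)
    (x : Param W n d → R) : map f (sumOfSplit x) = sumOfSplit (fun t => f (x t)) := by
  simp [sumOfSplit, unitForm, map_sum, map_prod]

/-- The generic coefficients of a sum of products of linear forms. -/
def genericCoeff (k : Type*) [Field k] (W : Type*) [Fintype W] (n d : ℕ) (m : Monomials n d) :
    MvPolynomial (Param W n d) k :=
  coeff m.1 (sumOfSplit (R := MvPolynomial (Param W n d) k) X)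

theorem eval_genericCoeff [Fintype W] (x : Param W n d → k) (m : Monomials n d) :
    eval x (genericCoeff k W n d m) = coeff m.1 (sumOfSplit x) := by
  rw [genericCoeff, ← coeff_map, map_sumOfSplit]
  simp

/-- The derivatives of a sum of products of linear forms with respect to the parameters. -/
def tangentVector [DecidableEq W] (x : Param W n d → k) : Param W n d → MvPolynomial (Fin (n + 1)) k
  | (w, none) => ∏ i, unitForm fun j => x (w, some (i, j))
  | (w, some (i, j)) => C (x (w, none)) *
      (X (Fin.succ j) * ∏ i' ∈ Finset.univ.erase i, unitForm fun j => x (w, some (i', j)))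

theorem hasCoeffDeriv_sumOfSplit [Fintype W] [DecidableEq W] (x : Param W n d → k)
    (t : Param W n d) :
    HasCoeffDeriv x t (sumOfSplit X) (sumOfSplit x) (tangentVector x t) := by
  classical
  have hu : ∀ w i, HasCoeffDeriv x t (unitForm fun j => X (w, some (i, j)))
      (unitForm fun j => x (w, some (i, j)))
      (∑ j, C (if t = (w, some (i, j)) then 1 else 0) * X (Fin.succ j)) := by
    intro w i
    have h := (hasCoeffDeriv_X (x := x) (t := t) (0 : Fin (n + 1))).add
      (hasCoeffDeriv_sum Finset.univ fun j _ =>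
        (hasCoeffDeriv_C (x := x) (t := t) (X (w, some (i, j)))).mul
          (hasCoeffDeriv_X (x := x) (t := t) (Fin.succ j)))
    convert h using 1
    · simp [unitForm]
    · simp [unitForm]
    · rw [zero_add]
      refine Finset.sum_congr rfl fun j _ => ?_
      rw [mul_zero, zero_add, pderiv_X]
      by_cases hj : t = (w, some (i, j))
      · subst hj; simp
      · simp [hj]
  have h := hasCoeffDeriv_sum Finset.univ fun w (_ : w ∈ (Finset.univ : Finset W)) =>
    (hasCoeffDeriv_C (x := x) (t := t) (X (w, none))).mul
      (hasCoeffDeriv_prod Finset.univ fun i _ => hu w i)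
  convert h using 1
  · simp [sumOfSplit]
  · simp [sumOfSplit]
  · obtain ⟨w, _ | ⟨i, j⟩⟩ := t
    · rw [Finset.sum_eq_single w]
      · simp [tangentVector]
      · intro w' _ hw'
        simp [pderiv_X, hw']
      · simp
    · rw [Finset.sum_eq_single w]
      · rw [Finset.sum_eq_single i]
        · rw [Finset.sum_eq_single j]
          · simp [tangentVector, pderiv_X]
          · intro j' _ hj'
            simp [hj'.symm]
          · simp
        · intro i' _ hi'
          simp [hi'.symm]
        · simp
      · intro w' _ hw'
        simp [pderiv_X, hw'.symm]
      · simp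

theorem eval_pderiv_genericCoeff [Fintype W] [DecidableEq W] (x : Param W n d → k)
    (t : Param W n d) (m : Monomials n d) :
    eval x (pderiv t (genericCoeff k W n d m)) = coeff m.1 (tangentVector x t) :=
  (hasCoeffDeriv_sumOfSplit x t m.1).2

theorem unitForm_isHomogeneous {R : Type*} [CommRing R] (a : Fin n → R) :
    (unitForm a).IsHomogeneous 1 :=
  (isHomogeneous_X _ _).add (IsHomogeneous.sum _ _ _ fun _ _ =>
    (isHomogeneous_X _ _).C_mul _)

theorem tangentVector_isHomogeneous [DecidableEq W] (x : Param W n d → k) (t : Param W n d) :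
    (tangentVector x t).IsHomogeneous d := by
  obtain ⟨w, _ | ⟨i, j⟩⟩ := t
  · have := IsHomogeneous.prod Finset.univ
      (fun i : Fin d => unitForm fun j => x (w, some (i, j))) (fun _ => 1)
      fun i _ => unitForm_isHomogeneous _
    simpa [tangentVector] using this
  · have h1 := IsHomogeneous.prod (Finset.univ.erase i)
      (fun i : Fin d => unitForm fun j => x (w, some (i, j))) (fun _ => 1)
      fun i _ => unitForm_isHomogeneous _
    have h2 := (isHomogeneous_C (Fin (n + 1)) (x (w, none))).mul
      ((isHomogeneous_X k (Fin.succ j)).mul h1)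
    have hd : 0 + (1 + ∑ i' ∈ Finset.univ.erase i, 1) = d := by
      have := i.pos
      simp
      omega
    rwa [hd] at h2

theorem mem_finsuppAntidiag_of_coeff_ne_zero {F : MvPolynomial (Fin (n + 1)) k}
    (hF : F.IsHomogeneous d) {m : Fin (n + 1) →₀ ℕ} (hm : coeff m F ≠ 0) :
    m ∈ Finset.finsuppAntidiag (Finset.univ : Finset (Fin (n + 1))) d := by
  rw [Finset.mem_finsuppAntidiag]
  refine ⟨?_, Finset.subset_univ _⟩
  rw [← Finsupp.degree_eq_sum]
  by_contra h
  exact hm (hF.coeff_eq_zero h)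

theorem card_param [Fintype W] : Fintype.card (Param W n d) = Fintype.card W * (d * n + 1) := by
  simp [Param]

/-- Linear forms in the coefficients dual to the tangent vectors are composed with the
parametrization; their Jacobian at `x` is the identity matrix. -/
theorem card_param_le_ringKrullDim [CharZero k] [Fintype W] [DecidableEq W]
    (x : Param W n d → k) (hx : LinearIndependent k (tangentVector x))
    (I : Ideal (MvPolynomial (Monomials n d) k))
    (hI : I ≤ RingHom.ker (aeval (genericCoeff k W n d))) :
    (Fintype.card (Param W n d) : WithBot ℕ∞) ≤ ringKrullDim (MvPolynomial (Monomials n d) k ⧸ I) := by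
  classical
  have hlin : LinearIndependent k fun t (m : Monomials n d) => coeff m.1 (tangentVector x t) := by
    rw [Fintype.linearIndependent_iff] at hx ⊢
    intro c hc
    refine hx c ?_
    ext m
    rw [coeff_zero, coeff_sum]
    by_cases hm : m ∈ Finset.finsuppAntidiag (Finset.univ : Finset (Fin (n + 1))) d
    · simpa [coeff_smul] using congrFun hc ⟨m, hm⟩
    · refine Finset.sum_eq_zero fun t _ => ?_
      rw [coeff_smul]
      have : coeff m (tangentVector x t) = 0 := by
        by_contra h
        exact hm (mem_finsuppAntidiag_of_coeff_ne_zero (tangentVector_isHomogeneous x t) h)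
      rw [this, smul_zero]
  -- The components of a left inverse of the differential are the dual linear forms.
  obtain ⟨g, hg⟩ := LinearMap.exists_leftInverse_of_injective _
    (LinearMap.ker_eq_bot.mpr (linearIndependent_iff_injective_fintypeLinearCombination.mp hlin))
  have hgt : ∀ t t', g (fun m => coeff m.1 (tangentVector x t')) t = if t = t' then 1 else 0 := by
    intro t t'
    have h1 := congrFun (LinearMap.congr_fun hg (Pi.single t' 1)) t
    simpa [Fintype.linearCombination_apply, Pi.single_apply] using h1
  have hsum : ∀ t t', ∑ m, coeff m.1 (tangentVector x t') * g (Pi.single m 1) t =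
      if t = t' then 1 else 0 := by
    intro t t'
    rw [← hgt t t']
    conv_rhs => rw [pi_eq_sum_univ' (fun m : Monomials n d => coeff m.1 (tangentVector x t'))]
    simp [map_sum, Finset.sum_apply]
  refine card_le_ringKrullDim_quotient (aeval (genericCoeff k W n d)) I hI
    (Ψ := fun t => ∑ m, C (g (Pi.single m 1) t) * X m) ?_
  refine algebraicIndependent_of_jacobian _ x ?_
  suffices h : (Matrix.of fun t t' => eval x (pderiv t' (aeval (genericCoeff k W n d)
      (∑ m, C (g (Pi.single m 1) t) * X m)))) = 1 by
    rw [h, Matrix.det_one]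
    exact one_ne_zero
  ext t t'
  rw [Matrix.of_apply, Matrix.one_apply, ← hsum t t', map_sum, map_sum, map_sum]
  refine Finset.sum_congr rfl fun m _ => ?_
  rw [map_mul, aeval_X, aeval_C, algebraMap_eq, pderiv_C_mul, map_mul, eval_C,
    eval_pderiv_genericCoeff, mul_comm]

end Parametrization

/-! ### Comparison of `2^(n-3) c(n, d)` with a binomial coefficient. -/

section Numerics

/-- One bound covers all residues modulo 6, so that the case distinction in `sTilde` is not needed
again. -/
theorem sTilde_le (D : ℕ) : sTilde D ≤ (((D + 1) / 2 : ℕ) : ℚ) * (((D + 1) / 2 : ℕ) + 1) / 6 := by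
  obtain ⟨q, t, ht, rfl⟩ : ∃ q t : ℕ, t < 6 ∧ D = 6 * q + t :=
    ⟨D / 6, D % 6, Nat.mod_lt _ (by norm_num), (Nat.div_add_mod D 6).symm⟩
  have hmod : (6 * q + t) % 6 = t := by omega
  have hdiv : (6 * q + t + 1) / 2 = 3 * q + (t + 1) / 2 := by omega
  rw [sTilde, hmod, hdiv]
  interval_cases t <;> norm_num <;> nlinarith

theorem c_le (n d m : ℕ) (hm : m ≤ n - 2) : c n d ≤ ⌊sTilde (d - m) / g n m⌋ :=
  Finset.inf'_le _ (Finset.mem_Icc.mpr ⟨Nat.zero_le _, hm⟩)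

theorem c_mul_g_le {n d m : ℕ} (hm : m ≤ n - 2) (hg : 0 < g n m) :
    (c n d : ℚ) * g n m ≤ sTilde (d - m) := by
  rw [← le_div_iff₀ hg]
  exact (Int.cast_le.mpr (c_le n d m hm)).trans (Int.floor_le _)

/-- The case `κ = 2J` of the next inequality, with `J = j + 2`. Passing from `J` to `J + 1`
multiplies the binomial coefficient by `(3J+3)(3J+2)(3J+1) / ((J+2)(2J+1)(2J))`, which outgrows the
corresponding factor on the left. -/
theorem four_pow_mul_le_choose_base (j : ℕ) :
    4 ^ (j + 2) * ((2 * (j + 2) + 1) * (2 * (j + 2) + 2)) ≤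
      12 * (j + 2) * (3 * (j + 2)).choose (j + 3) := by
  induction j with
  | zero => decide
  | succ j ih =>
    obtain ⟨J, hJ⟩ : ∃ J, J = j + 2 := ⟨_, rfl⟩
    rw [show j + 1 + 2 = J + 1 by omega, show j + 1 + 3 = J + 2 by omega]
    rw [← hJ, show j + 3 = J + 1 by omega] at ih
    have hJ0 : 0 < J := by omega
    have h1 := Nat.choose_mul_succ_eq (3 * J) (J + 1)
    have h2 := Nat.choose_mul_succ_eq (3 * J + 1) (J + 1)
    have h3 := Nat.add_one_mul_choose_eq (3 * J + 2) (J + 1)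
    rw [show 3 * J + 1 - (J + 1) = 2 * J by omega] at h1
    rw [show 3 * J + 1 + 1 - (J + 1) = 2 * J + 1 by omega] at h2
    have h4 : (3 * (J + 1)).choose (J + 2) * ((J + 2) * (2 * J + 1) * (2 * J)) =
        (3 * J).choose (J + 1) * ((3 * J + 3) * (3 * J + 2) * (3 * J + 1)) := by
      rw [show 3 * (J + 1) = 3 * J + 2 + 1 by ring]
      calc _ = ((3 * J + 2 + 1).choose (J + 1 + 1) * (J + 1 + 1)) * ((2 * J + 1) * (2 * J)) := by
            ring
        _ = (3 * J + 3) * ((3 * J + 1 + 1).choose (J + 1) * (2 * J + 1)) * (2 * J) := by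
            rw [← h3]; ring
        _ = (3 * J + 3) * (3 * J + 2) * ((3 * J + 1).choose (J + 1) * (2 * J)) := by
            rw [← h2]; ring
        _ = _ := by rw [← h1]; ring
    refine Nat.le_of_mul_le_mul_right ?_
      (show 0 < (J + 2) * (2 * J + 1) * (2 * J) * (J * (2 * J + 2)) by positivity)
    calc 4 ^ (J + 1) * ((2 * (J + 1) + 1) * (2 * (J + 1) + 2)) *
          ((J + 2) * (2 * J + 1) * (2 * J) * (J * (2 * J + 2)))
        = 4 ^ J * ((2 * J + 1) * (2 * J + 2)) *
          (4 * (2 * J + 3) * (2 * J + 4) * (J + 2) * (2 * J) * J) := by ring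
      _ ≤ 12 * J * (3 * J).choose (J + 1) *
          (4 * (2 * J + 3) * (2 * J + 4) * (J + 2) * (2 * J) * J) := Nat.mul_le_mul_right _ ih
      _ ≤ 12 * J * (3 * J).choose (J + 1) *
          ((J + 1) * (3 * J + 3) * (3 * J + 2) * (3 * J + 1) * (2 * J + 2)) := by
          refine Nat.mul_le_mul_left _ ?_
          ring_nf
          omega
      _ = 12 * J * (J + 1) * (2 * J + 2) *
          ((3 * J).choose (J + 1) * ((3 * J + 3) * (3 * J + 2) * (3 * J + 1))) := by ring
      _ = _ := by rw [← h4]; ring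

theorem four_pow_mul_le_choose {j κ : ℕ} (hj : 2 ≤ j) (hκ : 2 * j ≤ κ) :
    4 ^ j * ((κ + 1) * (κ + 2)) ≤ 12 * j * (κ + j).choose (j + 1) := by
  induction κ, hκ using Nat.le_induction with
  | base =>
    obtain ⟨j, rfl⟩ := Nat.exists_eq_add_of_le' hj
    have := four_pow_mul_le_choose_base j
    rw [show 2 * (j + 2) + (j + 2) = 3 * (j + 2) by ring]
    exact this
  | succ κ hκ ih =>
    have h1 : (κ + j + 1).choose (j + 1) * κ = (κ + j).choose (j + 1) * (κ + j + 1) := by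
      have := Nat.choose_mul_succ_eq (κ + j) (j + 1)
      rw [show κ + j + 1 - (j + 1) = κ by omega] at this
      exact this.symm
    rw [show κ + 1 + j = κ + j + 1 by ring]
    have hκ0 : 0 < (κ + 1) * κ := Nat.mul_pos (by omega) (by omega)
    refine Nat.le_of_mul_le_mul_right ?_ hκ0
    calc 4 ^ j * ((κ + 1 + 1) * (κ + 1 + 2)) * ((κ + 1) * κ)
        = 4 ^ j * ((κ + 1) * (κ + 2)) * ((κ + 3) * κ) := by ring
      _ ≤ 12 * j * (κ + j).choose (j + 1) * ((κ + 3) * κ) := Nat.mul_le_mul_right _ ih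
      _ ≤ 12 * j * (κ + j).choose (j + 1) * ((κ + 1) * (κ + j + 1)) := by
          refine Nat.mul_le_mul_left _ ?_
          nlinarith
      _ = 12 * j * ((κ + j + 1).choose (j + 1) * κ) * (κ + 1) := by rw [h1]; ring
      _ = _ := by ring

/-- Only a few terms of the minimum are needed. For `n = 4, 5` the term `m = 2` suffices. For `n ≥
6` the term `m = 0` bounds `s`, and `c ≥ 1`, combined with a term near the middle, forces `d` to be
large enough for `four_pow_mul_le_choose`. -/
theorem le_choose_of_le_two_pow_mul_c {n d s : ℕ} (hn : 4 ≤ n) (hd : n ≤ d) (hs : 1 ≤ s)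
    (hsc : (s : ℤ) ≤ 2 ^ (n - 3) * c n d) :
    s ≤ ((d - 1) / 2 - 1 + n / 2).choose (n / 2) := by
  obtain ⟨κ, hκ⟩ : ∃ κ, κ = (d - 1) / 2 := ⟨_, rfl⟩
  have hκ1 : 1 ≤ κ := by omega
  rw [← hκ]
  have hscQ : (s : ℚ) ≤ 2 ^ (n - 3) * (c n d : ℚ) := by exact_mod_cast hsc
  have hc : (1 : ℚ) ≤ c n d := by
    have h : 0 < 2 ^ (n - 3) * c n d := by omega
    have : 1 ≤ c n d := pos_of_mul_pos_right h (by positivity)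
    exact_mod_cast this
  rcases (by omega : n = 4 ∨ n = 5 ∨ 6 ≤ n) with rfl | rfl | hn6
  · have h1 := c_mul_g_le (n := 4) (d := d) (m := 2) (by norm_num) (by norm_num [g])
    have h2 := sTilde_le (d - 2)
    rw [show (d - 2 + 1) / 2 = κ by omega] at h2
    norm_num [g] at h1 hscQ
    have h3 : ((κ - 1 + 4 / 2).choose (4 / 2) : ℚ) = (κ + 1) * κ / 2 := by
      rw [show κ - 1 + 4 / 2 = κ + 1 by omega, Nat.cast_choose_two]
      push_cast
      ring
    have h4 : (s : ℚ) ≤ ((κ - 1 + 4 / 2).choose (4 / 2) : ℕ) := by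
      rw [h3]
      nlinarith
    exact_mod_cast h4
  · have h1 := c_mul_g_le (n := 5) (d := d) (m := 2) (by norm_num) (by norm_num [g])
    have h2 := sTilde_le (d - 2)
    rw [show (d - 2 + 1) / 2 = κ by omega] at h2
    norm_num [g] at h1 hscQ
    have h3 : ((κ - 1 + 5 / 2).choose (5 / 2) : ℚ) = (κ + 1) * κ / 2 := by
      rw [show κ - 1 + 5 / 2 = κ + 1 by omega, show 5 / 2 = 2 by norm_num, Nat.cast_choose_two]
      push_cast
      ring
    have h4 : (s : ℚ) ≤ ((κ - 1 + 5 / 2).choose (5 / 2) : ℕ) := by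
      rw [h3]
      nlinarith
    exact_mod_cast h4
  obtain ⟨j, hj⟩ : ∃ j, n / 2 = j + 1 := ⟨n / 2 - 1, by omega⟩
  have hj2 : 2 ≤ j := by omega
  have hj2Q : (2 : ℚ) ≤ j := by exact_mod_cast hj2
  rw [hj, show κ - 1 + (j + 1) = κ + j by omega]
  have hn' : n = 2 * j + 2 ∨ n = 2 * j + 3 := by omega
  -- Otherwise `d ≤ 4j`, and `sTilde (d - m)` would be smaller than `g n m` for `m = j`,
  -- contradicting `c ≥ 1`.
  have hκj : 2 * j ≤ κ := by
    by_contra hlt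
    have hK : ((d - j + 1) / 2 : ℕ) ≤ (3 * (j : ℚ) + 1) / 2 := by
      rw [le_div_iff₀ (by norm_num)]
      have : (d - j + 1) / 2 * 2 ≤ 3 * j + 1 := by omega
      exact_mod_cast this
    have hK0 : (0 : ℚ) ≤ ((d - j + 1) / 2 : ℕ) := Nat.cast_nonneg _
    have h2 := sTilde_le (d - j)
    have h3 : sTilde (d - j) ≤ (3 * (j : ℚ) + 1) / 2 * ((3 * (j : ℚ) + 1) / 2 + 1) / 6 :=
      h2.trans (by gcongr)
    rcases hn' with rfl | rfl
    -- For `n = 6` the term `m = j = 2` is too weak, since `g 6 2 = 2`; the term `m = 3` with `g 6 3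
    -- = 3` is used.
    · by_cases hj3 : j = 2
      · subst hj3
        have h1 := c_mul_g_le (n := 6) (d := d) (m := 3) (by norm_num) (by norm_num [g])
        have h5 := sTilde_le (d - 3)
        have h6 : (((d - 3 + 1) / 2 : ℕ) : ℚ) ≤ 3 := by
          have : (d - 3 + 1) / 2 ≤ 3 := by omega
          exact_mod_cast this
        have h7 : (0 : ℚ) ≤ ((d - 3 + 1) / 2 : ℕ) := Nat.cast_nonneg _
        norm_num [g] at h1
        nlinarith
      · have hj3' : (3 : ℚ) ≤ j := by exact_mod_cast (by omega : 3 ≤ j)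
        have hgj : g (2 * j + 2) j = j * (j - 1) := by
          rw [g, if_neg (by omega), if_neg (by omega), if_neg (by omega)]
          push_cast
          ring
        have h1 := c_mul_g_le (n := 2 * j + 2) (d := d) (m := j) (by omega) (by
          rw [hgj]; nlinarith)
        rw [hgj] at h1
        have h8 : (j : ℚ) * (j - 1) ≤ c (2 * j + 2) d * (j * (j - 1)) :=
          le_mul_of_one_le_left (by nlinarith) hc
        nlinarith
    · have hgj : g (2 * j + 3) j = j * j := by
        rw [g, if_neg (by omega), if_neg (by omega), if_neg (by omega)]
        push_cast
        ring
      have h1 := c_mul_g_le (n := 2 * j + 3) (d := d) (m := j) (by omega) (by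
        rw [hgj]; nlinarith)
      rw [hgj] at h1
      have h8 : (j : ℚ) * j ≤ c (2 * j + 3) d * (j * j) :=
        le_mul_of_one_le_left (by nlinarith) hc
      nlinarith
  have hmain : (4 : ℚ) ^ j * ((κ + 1) * (κ + 2)) ≤ 12 * j * (κ + j).choose (j + 1) := by
    exact_mod_cast four_pow_mul_le_choose hj2 hκj
  have hg0 : g n 0 = (n : ℚ) - 3 := by simp [g]
  have hn6Q : (6 : ℚ) ≤ n := by exact_mod_cast hn6
  have h1 := c_mul_g_le (n := n) (d := d) (m := 0) (by omega) (by rw [hg0]; linarith)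
  rw [hg0, Nat.sub_zero] at h1
  have h2 := sTilde_le d
  rw [show (d + 1) / 2 = κ + 1 by omega] at h2
  push_cast at h2
  have h5 : (s : ℚ) * (n - 3) * 6 ≤ 2 ^ (n - 3) * ((κ + 1) * (κ + 2)) := by
    have h6 : (c n d : ℚ) * (n - 3) * 6 ≤ (κ + 1) * (κ + 2) := by nlinarith
    calc (s : ℚ) * (n - 3) * 6 ≤ 2 ^ (n - 3) * (c n d : ℚ) * (n - 3) * 6 := by
          have : (0 : ℚ) ≤ (n : ℚ) - 3 := by linarith
          gcongr
      _ = 2 ^ (n - 3) * ((c n d : ℚ) * (n - 3) * 6) := by ring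
      _ ≤ _ := by gcongr
  have h9 : (s : ℚ) ≤ ((κ + j).choose (j + 1) : ℕ) := by
    have hj0 : (0 : ℚ) < j := by linarith
    rcases hn' with rfl | rfl
    · have hp : (2 : ℚ) ^ (2 * j - 1) * 2 = 4 ^ j := by
        rw [← pow_succ, show 2 * j - 1 + 1 = 2 * j by omega, pow_mul]
        norm_num
      push_cast at h5
      have h10 : (s : ℚ) * (2 * j - 1) * 12 ≤ 12 * j * (κ + j).choose (j + 1) := by
        refine le_trans ?_ hmain
        rw [← hp]
        nlinarith
      have h11 : (s : ℚ) * j ≤ s * (2 * j - 1) := by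
        gcongr
        linarith
      refine le_of_mul_le_mul_right ?_ hj0
      linarith
    · have hp : (2 : ℚ) ^ (2 * j) = 4 ^ j := by
        rw [pow_mul]
        norm_num
      push_cast at h5
      rw [hp] at h5
      refine le_of_mul_le_mul_right ?_ hj0
      linarith
  exact_mod_cast h9

end Numerics

/-! ### From the parametrization to the dimensions of `Split` and its secant varieties. -/

section Cones

open MvPolynomial

variable {k : Type*} [Field k] {n d : ℕ} {W : Type*}

/-- The coefficient vector of a form. -/
def coeffsOfForm (F : MvPolynomial (Fin (n + 1)) k) : Monomials n d → k := fun m => coeff m.1 F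

theorem coeff_formOfCoeffs (a : Monomials n d → k) (m : Monomials n d) :
    coeff m.1 (formOfCoeffs a) = a m := by
  classical
  rw [formOfCoeffs, coeff_sum, Finset.sum_eq_single m]
  · simp
  · intro m' _ hm'
    rw [coeff_monomial, if_neg fun h => hm' (Subtype.ext h)]
  · simp

theorem formOfCoeffs_coeffsOfForm {F : MvPolynomial (Fin (n + 1)) k} (hF : F.IsHomogeneous d) :
    formOfCoeffs (coeffsOfForm F : Monomials n d → k) = F := by
  classical
  ext m
  by_cases hm : m ∈ Finset.finsuppAntidiag (Finset.univ : Finset (Fin (n + 1))) d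
  · exact coeff_formOfCoeffs _ ⟨m, hm⟩
  · have h0 : coeff m F = 0 := by
      by_contra h
      exact hm (mem_finsuppAntidiag_of_coeff_ne_zero hF h)
    rw [h0, formOfCoeffs, coeff_sum]
    refine Finset.sum_eq_zero fun m' _ => ?_
    rw [coeff_monomial, if_neg fun h : m'.1 = m => hm (h ▸ m'.2)]

theorem formOfCoeffs_smul (c : k) (a : Monomials n d → k) :
    formOfCoeffs (c • a) = C c * formOfCoeffs a := by
  rw [formOfCoeffs, formOfCoeffs, Finset.mul_sum]
  exact Finset.sum_congr rfl fun m _ => by rw [C_mul_monomial, Pi.smul_apply, smul_eq_mul]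

theorem IsCompletelyDecomposable.isHomogeneous {F : MvPolynomial (Fin (n + 1)) k}
    (hF : IsCompletelyDecomposable d F) : F.IsHomogeneous d := by
  obtain ⟨l, hl, rfl⟩ := hF
  simpa using IsHomogeneous.prod Finset.univ l (fun _ => 1) fun i _ => hl i

theorem IsCompletelyDecomposable.C_mul (hd : 1 ≤ d) {F : MvPolynomial (Fin (n + 1)) k}
    (hF : IsCompletelyDecomposable d F) (c : k) : IsCompletelyDecomposable d (C c * F) := by
  obtain ⟨l, hl, rfl⟩ := hF
  obtain ⟨d, rfl⟩ := Nat.exists_eq_add_of_le' hd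
  refine ⟨Fin.cons (C c * l 0) (Fin.tail l), fun i => ?_, ?_⟩
  · induction i using Fin.cases with
    | zero => exact (hl 0).C_mul c
    | succ i => exact hl i.succ
  · rw [Fin.prod_univ_succ, Fin.prod_univ_succ, ← mul_assoc]
    rfl

theorem isCompletelyDecomposable_zero (hd : 1 ≤ d) :
    IsCompletelyDecomposable d (0 : MvPolynomial (Fin (n + 1)) k) := by
  refine ⟨fun _ => 0, fun _ => isHomogeneous_zero _ _ _, ?_⟩
  rw [Finset.prod_const, zero_pow]
  simpa using Nat.one_le_iff_ne_zero.mp hd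

theorem isCompletelyDecomposable_of_mem_affineCone (hd : 1 ≤ d) {v : Monomials n d → k}
    (hv : v ∈ affineCone (Split k n d)) : IsCompletelyDecomposable d (formOfCoeffs v) := by
  by_cases h0 : v = 0
  · have : formOfCoeffs v = 0 := by
      rw [h0]
      simp [formOfCoeffs]
    rw [this]
    exact isCompletelyDecomposable_zero hd
  · obtain ⟨a, ha, hva, hdec⟩ := hv h0
    obtain ⟨c, rfl⟩ := (Projectivization.mk_eq_mk_iff' k v a h0 ha).mp hva
    rw [formOfCoeffs_smul]
    exact hdec.C_mul hd c

theorem coeffsOfForm_mem_affineCone {F : MvPolynomial (Fin (n + 1)) k}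
    (hF : IsCompletelyDecomposable d F) :
    (coeffsOfForm F : Monomials n d → k) ∈ affineCone (Split k n d) := fun h0 =>
  ⟨_, h0, rfl, by rwa [formOfCoeffs_coeffsOfForm hF.isHomogeneous]⟩

theorem split_nonempty (k : Type*) [Field k] (n d : ℕ) : (Split k n d).Nonempty := by
  have hF : IsCompletelyDecomposable d (X 0 ^ d : MvPolynomial (Fin (n + 1)) k) :=
    ⟨fun _ => X 0, fun _ => isHomogeneous_X _ _, by simp⟩
  have h0 : (coeffsOfForm (X 0 ^ d) : Monomials n d → k) ≠ 0 := by
    intro h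
    have h1 := formOfCoeffs_coeffsOfForm hF.isHomogeneous
    rw [h] at h1
    simp [formOfCoeffs] at h1
    exact pow_ne_zero d (X_ne_zero (R := k) (0 : Fin (n + 1))) h1.symm
  exact ⟨_, coeffsOfForm_mem_affineCone hF h0⟩

theorem subset_zariskiClosure {ι : Type*} (X : Set (ℙ k (ι → k))) : X ⊆ zariskiClosure X :=
  fun p hp _ _ _ h => h p hp

theorem sum_mem_affineCone_secantVariety {ι : Type*} {s : ℕ} {X : Set (ℙ k (ι → k))}
    (hX : X.Nonempty) {v : Fin s → ι → k} (hv : ∀ i, v i ∈ affineCone X) :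
    ∑ i, v i ∈ affineCone (secantVariety s X) := by
  classical
  intro h0
  -- A zero summand represents no point; the arbitrary point `p0` takes its place in the span.
  obtain ⟨p0, hp0⟩ := hX
  refine subset_zariskiClosure _
    ⟨fun i => if h : v i ≠ 0 then Projectivization.mk k (v i) h else p0, fun i => ?_, ?_⟩
  · dsimp only
    split_ifs with h
    · exact hv i h
    · exact hp0
  · rw [← SetLike.mem_coe, SetLike.mem_coe, ← Projectivization.Subspace.mem_submodule_iff _ h0]
    refine Submodule.sum_mem _ fun i _ => fun hi => ?_
    refine Projectivization.Subspace.subset_span _ ⟨i, ?_⟩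
    dsimp only
    rw [dif_pos hi]

theorem isCompletelyDecomposable_C_mul_prod_unitForm (hd : 1 ≤ d) (c : k) (a : Fin d → Fin n → k) :
    IsCompletelyDecomposable d (C c * ∏ i, unitForm (a i)) :=
  IsCompletelyDecomposable.C_mul hd ⟨_, fun i => unitForm_isHomogeneous (a i), rfl⟩ c

theorem aeval_eq_zero_iff_forall_eval [Infinite k] [Fintype W]
    (F : MvPolynomial (Monomials n d) k) :
    aeval (genericCoeff k W n d) F = 0 ↔
      ∀ x : Param W n d → k, eval (coeffsOfForm (sumOfSplit x)) F = 0 := by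
  have h : ∀ x : Param W n d → k, eval x (aeval (genericCoeff k W n d) F) =
      eval (coeffsOfForm (sumOfSplit x)) F := by
    intro x
    induction F using MvPolynomial.induction_on with
    | C a => simp
    | add p q hp hq => rw [map_add, map_add, map_add, hp, hq]
    | mul_X p m hp =>
      rw [map_mul, map_mul, map_mul, hp, aeval_X, eval_X, eval_genericCoeff, coeffsOfForm]
  constructor
  · intro h0 x
    rw [← h, h0, map_zero]
  · intro h0
    refine MvPolynomial.funext fun x => ?_
    rw [h, h0, map_zero]

theorem vanishingIdeal_secantVariety_le [Infinite k] (hd : 1 ≤ d) (s : ℕ) :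
    vanishingIdeal k (affineCone (secantVariety s (Split k n d))) ≤
      RingHom.ker (aeval (genericCoeff k (Fin s) n d)) := by
  intro F hF
  rw [RingHom.mem_ker]
  refine (aeval_eq_zero_iff_forall_eval F).mpr fun x => ?_
  have h := sum_mem_affineCone_secantVariety (s := s) (split_nonempty k n d) fun w =>
    coeffsOfForm_mem_affineCone (isCompletelyDecomposable_C_mul_prod_unitForm hd (x (w, none))
      fun i j => x (w, some (i, j)))
  have h1 := hF _ h
  rw [aeval_eq_eval] at h1
  have h2 : (coeffsOfForm (sumOfSplit x) : Monomials n d → k) = ∑ w, coeffsOfForm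
      (C (x (w, none)) * ∏ i, unitForm fun j => x (w, some (i, j))) := by
    funext m
    simp only [coeffsOfForm, sumOfSplit, coeff_sum, Finset.sum_apply]
  rwa [h2]

theorem exists_eq_single_of_degree_eq_one {σ : Type*} {m : σ →₀ ℕ} (hm : m.degree = 1) :
    ∃ j, m = Finsupp.single j 1 := by
  classical
  have h0 : m ≠ 0 := by
    rintro rfl
    simp at hm
  obtain ⟨j, hj⟩ := Finsupp.ne_iff.mp h0
  have h1 : Finsupp.single j 1 ≤ m :=
    Finsupp.single_le_iff.mpr (Nat.one_le_iff_ne_zero.mpr hj)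
  obtain ⟨m', rfl⟩ := exists_add_of_le h1
  refine ⟨j, ?_⟩
  rw [map_add, Finsupp.degree_single] at hm
  rw [(Finsupp.degree_eq_zero_iff m').mp (by omega), add_zero]

theorem exists_linear_coefficients {l : MvPolynomial (Fin (n + 1)) k} (hl : l.IsHomogeneous 1) :
    ∃ (α : k) (β : Fin n → k), l = C α * X 0 + ∑ j, C (β j) * X (Fin.succ j) := by
  refine ⟨coeff (Finsupp.single 0 1) l, fun j => coeff (Finsupp.single j.succ 1) l, ?_⟩
  rw [← Fin.sum_univ_succ fun j => C (coeff (Finsupp.single j 1) l) * X j]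
  classical
  ext m
  rw [coeff_sum]
  by_cases hm : m.degree = 1
  · obtain ⟨j, rfl⟩ := exists_eq_single_of_degree_eq_one hm
    rw [Finset.sum_eq_single j]
    · simp
    · intro i _ hij
      rw [coeff_C_mul, coeff_X, if_neg fun h => hij (Finsupp.single_left_injective one_ne_zero h),
        mul_zero]
    · simp
  · rw [hl.coeff_eq_zero hm]
    refine (Finset.sum_eq_zero fun i _ => ?_).symm
    rw [coeff_C_mul, coeff_X, if_neg fun h => hm (by rw [← h]; simp), mul_zero]

/-- The parametrization misses products with a factor not involving `X 0`. These are limits of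
parametrized ones: replacing each factor `l i` by `l i + t X 0` leaves the image for only finitely
many `t`. -/
theorem ker_le_vanishingIdeal_split [Infinite k] (hd : 1 ≤ d) :
    RingHom.ker (aeval (genericCoeff k (Fin 1) n d)) ≤
      vanishingIdeal k (affineCone (Split k n d)) := by
  intro F hF v hv
  rw [RingHom.mem_ker] at hF
  replace hF := (aeval_eq_zero_iff_forall_eval F).mp hF
  obtain ⟨l, hl, hvl⟩ := isCompletelyDecomposable_of_mem_affineCone hd hv
  have hv' : v = coeffsOfForm (∏ i, l i) := by
    ext m
    rw [← hvl, coeffsOfForm, coeff_formOfCoeffs]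
  choose α β hαβ using fun i => exists_linear_coefficients (hl i)
  -- the forms `∏ i, (l i + t X 0)` as a curve
  let P : MvPolynomial (Fin (n + 1)) (Polynomial k) :=
    ∏ i, (map Polynomial.C (l i) + C Polynomial.X * X 0)
  let Q : Polynomial k := eval₂ Polynomial.C (fun m : Monomials n d => coeff m.1 P) F
  have hQ : ∀ t : k, Q.eval t = eval (coeffsOfForm (∏ i, (l i + C t * X 0))) F := by
    intro t
    have hP : map (Polynomial.evalRingHom t) P = ∏ i, (l i + C t * X 0) := by
      rw [map_prod]
      refine Finset.prod_congr rfl fun i _ => ?_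
      have hc : (Polynomial.evalRingHom t).comp Polynomial.C = RingHom.id k := by
        ext a; simp
      rw [map_add, map_mul, map_C, map_X, map_map, hc, map_id]
      simp
    rw [← hP, ← Polynomial.coe_evalRingHom, hom_eval₂]
    rw [show (Polynomial.evalRingHom t).comp Polynomial.C = RingHom.id k by ext a; simp]
    have hc : (coeffsOfForm (map (Polynomial.evalRingHom t) P) : Monomials n d → k) =
        Polynomial.evalRingHom t ∘ fun m => coeff m.1 P := funext fun m => coeff_map _ _ _
    rw [hc]
    rfl
  -- The second factor vanishes at exactly the values of `t` for which some factor cannot be scaled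
  -- to coefficient `1` at `X 0`.
  have hQ0 : Q * ∏ i, (Polynomial.X + Polynomial.C (α i)) = 0 := by
    refine Polynomial.funext fun t => ?_
    rw [Polynomial.eval_mul, Polynomial.eval_zero, Polynomial.eval_prod]
    by_cases ht : ∃ i, t + α i = 0
    · obtain ⟨i, hi⟩ := ht
      rw [Finset.prod_eq_zero (Finset.mem_univ i) (by simpa using hi), mul_zero]
    · push Not at ht
      have h := hF fun p => p.2.elim (∏ i, (t + α i)) fun q => β q.1 q.2 / (t + α q.1)
      have hs : sumOfSplit (fun p : Param (Fin 1) n d =>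
          p.2.elim (∏ i, (t + α i)) fun q => β q.1 q.2 / (t + α q.1)) =
          ∏ i, (l i + C t * X 0) := by
        simp only [sumOfSplit, Fin.sum_univ_one, Option.elim_none, Option.elim_some]
        rw [map_prod, ← Finset.prod_mul_distrib]
        refine Finset.prod_congr rfl fun i _ => ?_
        rw [unitForm, hαβ i, mul_add, Finset.mul_sum, C_add]
        have hj : ∀ j, C (t + α i) * (C (β i j / (t + α i)) * X (Fin.succ j)) =
            C (β i j) * (X (Fin.succ j) : MvPolynomial (Fin (n + 1)) k) := fun j => by
          rw [← mul_assoc, ← C_mul, mul_div_cancel₀ _ (ht i)]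
        rw [← C_add, Finset.sum_congr rfl fun j _ => hj j, C_add]
        ring
      rw [hQ, ← hs, h, zero_mul]
  have hQz : Q = 0 := by
    refine (mul_eq_zero.mp hQ0).resolve_right (Finset.prod_ne_zero_iff.mpr fun i _ => ?_)
    exact Polynomial.X_add_C_ne_zero _
  have h0 := hQ 0
  rw [hQz, Polynomial.eval_zero] at h0
  rw [aeval_eq_eval, hv', h0]
  simp

theorem projDim_split_le [Infinite k] (hd : 1 ≤ d) : projDim (Split k n d) ≤ d * n := by
  have h := ringKrullDim_quotient_le_card _ _ (ker_le_vanishingIdeal_split (k := k) (n := n) hd)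
  rw [card_param, Fintype.card_fin, one_mul] at h
  change coneDim (Split k n d) ≤ _ at h
  rw [coneDim_eq_coe] at h
  have h1 : ((coneDim (Split k n d)).unbotD 0).toNat ≤ d * n + 1 := by exact_mod_cast h
  rw [projDim]
  push_cast [← Int.ofNat_le] at h1
  linarith

theorem secantNondefective_split_of_tangent [CharZero k] (hd : 1 ≤ d) {s : ℕ}
    (x : Param (Fin s) n d → k) (hx : LinearIndependent k (tangentVector x)) :
    SecantNondefective s (Split k n d) := by
  have h := card_param_le_ringKrullDim x hx _ (vanishingIdeal_secantVariety_le hd s)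
  rw [card_param, Fintype.card_fin] at h
  change _ ≤ coneDim (secantVariety s (Split k n d)) at h
  rw [coneDim_eq_coe] at h
  have h1 : s * (d * n + 1) ≤ ((coneDim (secantVariety s (Split k n d))).unbotD 0).toNat := by
    exact_mod_cast h
  have h2 := projDim_split_le (k := k) (n := n) hd
  have h3 : (s : ℤ) * (projDim (Split k n d) + 1) ≤ s * (d * n + 1) := by gcongr
  rw [SecantNondefective, SecantDefective, not_lt, expectedDim]
  -- An upper bound for the dimension of `Split` is enough here, because it only enters the expected
  -- dimension.
  refine (min_le_left _ _).trans ?_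
  have h4 : (s : ℤ) * (d * n + 1) ≤
      ((((coneDim (secantVariety s (Split k n d))).unbotD 0).toNat : ℕ) : ℤ) := by
    exact_mod_cast h1
  have h5 : projDim (secantVariety s (Split k n d)) =
      ((((coneDim (secantVariety s (Split k n d))).unbotD 0).toNat : ℕ) : ℤ) - 1 := rfl
  rw [h5]
  linarith

end Cones

/-! ### Choice of the point of the parameter space and conclusion. -/

section Main

open MvPolynomial

variable {k : Type*} [Field k] [CharZero k] {n d κ s : ℕ}

theorem exists_tangentVector_linearIndependent {M : Fin s → Fin 2 → Fin (n + 2) → k}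
    (hS : LinesSeparated κ M) (hN : LinesNormalized M) (hd : 2 * κ + 1 ≤ d) :
    ∃ x : Param (Fin s) (n + 1) d → k, LinearIndependent k (tangentVector x) := by
  -- The scalars are `1` and the `i`-th factor is the member `ℓ_0 - i ℓ_1` of the pencil.
  -- Normalization gives it coefficient `1` at `X 0`, as the parametrization requires.
  let x : Param (Fin s) (n + 1) d → k := fun p =>
    p.2.elim 1 fun q => M p.1 0 q.2.succ - ((q.1 : ℕ) : k) * M p.1 1 q.2.succ
  have hM : ∀ w, M w 0 0 = 1 ∧ M w 1 0 = 0 := by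
    intro w
    have h0 := (hN w).1
    simp only [pullback, aeval_X, linForm, Fin.sum_univ_two] at h0
    have e1 := congrArg (eval ![1, 0]) h0
    have e2 := congrArg (eval ![0, 1]) h0
    simp at e1 e2
    exact ⟨e1, e2⟩
  have hu : ∀ w (i : Fin d), unitForm (fun j => x (w, some (i, j))) =
      aeval (fun r => linForm (M w r)) (binLin k i) := by
    intro w i
    simp only [x, unitForm, binLin, map_sub, map_mul, aeval_X, aeval_C, linForm, algebraMap_eq,
      Option.elim_some]
    rw [Fin.sum_univ_succ (fun j => C (M w 0 j) * X j),
      Fin.sum_univ_succ (fun j => C (M w 1 j) * X j), (hM w).1, (hM w).2,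
      C_1, C_0, one_mul, zero_mul, zero_add, Finset.mul_sum, add_sub_assoc,
      ← Finset.sum_sub_distrib]
    congr 1
    refine Finset.sum_congr rfl fun j _ => ?_
    rw [← mul_assoc, ← sub_mul]
  refine ⟨x, Fintype.linearIndependent_iff.mpr fun a ha => ?_⟩
  rw [Fintype.sum_prod_type] at ha
  have h := tangent_independent hS hN hd (fun w => a (w, none))
    (fun w i j => a (w, some (i, j))) (by
      rw [← ha]
      refine Finset.sum_congr rfl fun w _ => ?_
      rw [Fintype.sum_option, Fintype.sum_prod_type]
      simp only [tangentVector, hu, smul_eq_C_mul, map_prod]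
      simp [x])
  rintro ⟨w, _ | ⟨i, j⟩⟩
  · exact (h w).1
  · exact (h w).2 i j

theorem secantNondefective_split_of_le_choose (hn : 4 ≤ n) (hd : n ≤ d)
    (hs : s ≤ ((d - 1) / 2 - 1 + n / 2).choose (n / 2)) :
    SecantNondefective s (Split k n d) := by
  obtain ⟨n, rfl⟩ := Nat.exists_eq_add_of_le' (by omega : 1 ≤ n)
  rw [← card_simplexIndex, ← Fintype.card_fin s] at hs
  obtain ⟨f⟩ := Function.Embedding.nonempty_of_card_le hs
  have hS := linesSeparated_simplex (k := k) (n := n + 1) (r := (n + 1) / 2) hn (by omega)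
    (by omega) ((d - 1) / 2 - 1)
  obtain ⟨x, hx⟩ := exists_tangentVector_linearIndependent (s := s) (d := d)
    (M := fun i => lineMatrix (n + 1) (simplexPoint k (f i).1)) (fun w p q hpq => by
      obtain ⟨G, hG, hG'⟩ := hS (f w) p q hpq
      exact ⟨G, hG, fun w' hw' => hG' (f w') (f.injective.ne hw')⟩)
    (fun w => ⟨pullback_lineMatrix_X_zero hn _, by
      have h1 : (1 : Fin (n + 1 + 1)) = ⟨1, by omega⟩ := Fin.ext (Fin.val_one _)
      rw [h1]
      exact pullback_lineMatrix_X_one hn (simplexPoint k (f w).1)⟩) (by omega)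
  exact secantNondefective_split_of_tangent (by omega) x hx

end Main

end SplitSecant

end

theorem theorem1p1p3 {k : Type*} [Field k] [IsAlgClosed k] [CharZero k]
    (n d s : ℕ) (hn : 4 ≤ n) (hd : n ≤ d) (hs : 1 ≤ s)
    (hsc : (s : ℤ) ≤ 2 ^ (n - 3) * SplitSecant.c n d) :
    SplitSecant.SecantNondefective s (SplitSecant.Split k n d) :=
  SplitSecant.secantNondefective_split_of_le_choose hn hd
    (SplitSecant.le_choose_of_le_two_pow_mul_c hn hd hs hsc)
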